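/- **Conventions.** A Hex board is an $m\times n$ array of hexagonal cells together with its four edges; the top and bottom edges are Black's, the left and right edges are White's. A region of the board that is connected and has connected complement (cells and edges outside it) is called *3-terminal* if every cell adjacent to it (and outside it) carries a black or white stone, and the cells and board edges adjacent to it form exactly three connected black components and exactly three connected white components. The black components are called its terminals and are labelled $1,2,3$. A *3-terminal Hex position* $G$ is the contents (black stones, white stones, empty cells) of a 3-terminal region. When its empty cells are filled with stones, its outcome is one of the elements of $P_3=\{\bot,a,b,c,\top\}$, where $\bot<a,b,c<\top$ and $a,b,c$ are pairwise incomparable: $\bot$ if no two black terminals are connected within the region, $a$ (resp. $b$, $c$) if exactly the terminals $2,3$ (resp. $1,3$; $1,2$) are connected, and $\top$ if all three are connected. A *Hex context* $C$ is a position (with or without empty cells) on a Hex board with a hole, the hole being a 3-terminal region. The *plugged-in game* $G\odot C$ is played on the empty cells of $G$ and of $C$ together, terminal $i$ of $G$ being identified with terminal $i$ of the hole; when all cells are filled, its outcome is $\top$ (Black wins) if the top and bottom edges are connected by black stones of $C$, passing through the hole between two terminals only if these are connected in the outcome of $G$, and it is $\bot$ (White wins) otherwise. Game forms over a poset $A$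 are generated by the atoms $[x]$, $x\in A$, and the composites $\{L\,|\,R\}$ with non-empty sets $L,R$ of game forms. Write $G^{(L)}$ for a left option of $G$ if $G$ is composite and for $G$ itself if $G$ is atomic, and similarly $G^{(R)}$. Define recursively: $G\le H$ iff $G^{(L)}\lhd H$ for all $G^{(L)}$ and $G\lhd H^{(R)}$ for all $H^{(R)}$; and $G\lhd H$ iff some right option satisfies $G^R\le H$, or some left option satisfies $G\le H^L$, or $G=[x]$, $H=[y]$ with $x\le y$ in $A$. Let $G\simeq H$ mean $G\le H$ and $H\le G$. A position with empty cells is regarded as the composite game form whose left (right) options are the positions obtained by putting one black (white) stone on an empty cell; a completely filled position is the atom given by its outcome. Thus $G$ is a game form over $P_3$ and $G\odot C$ is a game form over $\{\bot<\top\}$. **Proposition.** There is no Hex context $C$ such that, for all 3-terminal Hex positions $G$, $$G\odot C\simeq\top \quad\text{if and only if}\quad G\simeq\top .$$ -/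

import Mathlib

/-! ### Game forms over an outcome poset -/

/-- Game forms over `A`: an atomic game `[a]`, or a composite game `{L | R}` whose non-empty
collections of left and right options are given as families. -/
inductive GameForm (A : Type) : Type 1
  | atom (a : A) : GameForm A
  | node {ι κ : Type} (hι : Nonempty ι) (hκ : Nonempty κ)
      (L : ι → GameForm A) (R : κ → GameForm A) : GameForm A

namespace GameForm

/-- `G.IsLeft G'`: the game `G'` is a left option of `G`. -/
def IsLeft {A : Type} : GameForm A → GameForm A → Prop
  | atom _, _ => False
  | node _ _ L _, G' => ∃ i, L i = G'

/-- `G.IsRight G'`: the game `G'` is a right option of `G`. -/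
def IsRight {A : Type} : GameForm A → GameForm A → Prop
  | atom _, _ => False
  | node _ _ _ R, G' => ∃ k, R k = G'

/-- `G'` is a typical `G^(L)`: a left option if `G` is composite, `G` itself if `G` is atomic. -/
def IsLeftOrSelf {A : Type} : GameForm A → GameForm A → Prop
  | atom a, G' => G' = atom a
  | node _ _ L _, G' => ∃ i, L i = G'

/-- `G'` is a typical `G^(R)`: a right option if `G` is composite, `G` itself if `G` is atomic. -/
def IsRightOrSelf {A : Type} : GameForm A → GameForm A → Prop
  | atom a, G' => G' = atom a
  | node _ _ _ R, G' => ∃ k, R k = G'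

mutual
/-- `G ≤ H`: every `G^(L)` satisfies `G^(L) ⊲ H` and every `H^(R)` satisfies `G ⊲ H^(R)`. -/
inductive Le {A : Type} [PartialOrder A] : GameForm A → GameForm A → Prop
  | intro {G H : GameForm A}
      (hL : ∀ G', G.IsLeftOrSelf G' → Tri G' H)
      (hR : ∀ H', H.IsRightOrSelf H' → Tri G H') : Le G H
/-- `G ⊲ H`: some `G^R ≤ H`, or `G ≤` some `H^L`, or `G = [a]`, `H = [b]` with `a ≤ b`. -/
inductive Tri {A : Type} [PartialOrder A] : GameForm A → GameForm A → Prop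
  | ofRight {G H G' : GameForm A} (hG : G.IsRight G') (h : Le G' H) : Tri G H
  | ofLeft {G H H' : GameForm A} (hH : H.IsLeft H') (h : Le G H') : Tri G H
  | ofAtom {a b : A} (h : a ≤ b) : Tri (atom a) (atom b)
end

/-- Equivalence of game forms; two game forms have the same value if they are equivalent. -/
def Equiv {A : Type} [PartialOrder A] (G H : GameForm A) : Prop := Le G H ∧ Le H G

end GameForm

/-! ### Set coloring games and their game forms -/

/-- The two players; Black is the left player, White is the right player. -/
inductive Color
  | black
  | white
  deriving DecidableEq

/-- The game form of the position `p` (with `none` marking an empty cell) of the set coloring game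
with set of cells `X` and with outcome `π f` when the board has been filled according to `f`.
As long as there is an empty cell, the left (right) options are obtained by putting one black
(white) stone on an empty cell. -/
noncomputable def positionForm {X A : Type} [Finite X] (π : (X → Color) → A)
    (p : X → Option Color) : GameForm A :=
  open Classical in
  if h : ∃ x, p x = none then
    GameForm.node (ι := {x : X // p x = none}) (κ := {x : X // p x = none})
      (h.elim fun x hx => ⟨⟨x, hx⟩⟩) (h.elim fun x hx => ⟨⟨x, hx⟩⟩)
      (fun x => positionForm π (Function.update p x.1 (some Color.black)))
      (fun x => positionForm π (Function.update p x.1 (some Color.white)))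
  else
    GameForm.atom (π fun x => (p x).getD Color.white)
termination_by {x | p x = none}.ncard
decreasing_by
  all_goals
    classical
    refine Set.ncard_lt_ncard ⟨fun y hy => ?_, fun hs => ?_⟩ (Set.toFinite _)
    · by_cases hyx : y = x.1
      · rw [hyx]; exact x.2
      · have hy' : Function.update p x.1 _ y = none := hy
        rwa [Function.update_of_ne hyx] at hy'
    · have := hs x.2
      simp at this

/-! ### Hex boards -/

/-- The cells of a Hex board with `m` columns and `n` rows. -/
abbrev HexCell (m n : ℕ) : Type := Fin m × Fin n

/-- The four edges of a Hex board. -/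
inductive HexEdge
  | top
  | bottom
  | left
  | right
  deriving DecidableEq

/-- Top and bottom are Black's edges, left and right are White's edges. -/
def HexEdge.color : HexEdge → Color
  | top => Color.black
  | bottom => Color.black
  | left => Color.white
  | right => Color.white

/-- The cells of the board together with its four edges. -/
abbrev HexVertex (m n : ℕ) : Type := HexCell m n ⊕ HexEdge

/-- Generating relation for `hexGraph`. Cell `(i, j)` is a neighbor of `(i+1, j)`, `(i, j+1)` and
`(i+1, j-1)`; a cell in an outermost row or column is adjacent to the corresponding edge; and
edges of the board that meet in a corner are adjacent. -/
def HexRel (m n : ℕ) : HexVertex m n → HexVertex m n → Prop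
  | Sum.inl p, Sum.inl q =>
      (p.1.val + 1 = q.1.val ∧ p.2.val = q.2.val) ∨
      (p.1.val = q.1.val ∧ p.2.val + 1 = q.2.val) ∨
      (p.1.val + 1 = q.1.val ∧ p.2.val = q.2.val + 1)
  | Sum.inl p, Sum.inr HexEdge.top => p.2.val = 0
  | Sum.inl p, Sum.inr HexEdge.bottom => p.2.val + 1 = n
  | Sum.inl p, Sum.inr HexEdge.left => p.1.val = 0
  | Sum.inl p, Sum.inr HexEdge.right => p.1.val + 1 = m
  | Sum.inr e, Sum.inr e' => e.color ≠ e'.color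
  | Sum.inr _, Sum.inl _ => False

/-- The adjacency graph of cells and edges of a Hex board. -/
def hexGraph (m n : ℕ) : SimpleGraph (HexVertex m n) := SimpleGraph.fromRel (HexRel m n)

/-- The color of a cell (if it is not empty) or edge of the board. -/
def vertexColor {m n : ℕ} (p : HexCell m n → Option Color) : HexVertex m n → Option Color
  | Sum.inl x => p x
  | Sum.inr e => some e.color

/-- The boundary of a region: all cells and edges outside of the region that are adjacent to it. -/
def regionBoundary {m n : ℕ} (R : Set (HexCell m n)) : Set (HexVertex m n) :=
  {v | v ∉ Sum.inl '' R ∧ ∃ x ∈ R, (hexGraph m n).Adj v (Sum.inl x)}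

/-- The set `S` of vertices of the graph has exactly three connected components, namely
`t 0`, `t 1` and `t 2`. -/
def IsThreeComponents {V : Type} (Γ : SimpleGraph V) (S : Set V) (t : Fin 3 → Set V) : Prop :=
  (⋃ i, t i) = S ∧ (∀ i, (Γ.induce (t i)).Connected) ∧
    ∀ i j, i ≠ j → ∀ u ∈ t i, ∀ v ∈ t j, u ≠ v ∧ ¬ Γ.Adj u v

/-- A position on a Hex board together with a 3-terminal region: a region of the board without
holes (the region and its complement are connected) that is completely surrounded by stones
and board edges, such that its boundary has three black and three white components, the
terminals, which are labelled. -/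
structure MarkedHexBoard where
  /-- number of columns -/
  m : ℕ
  /-- number of rows -/
  n : ℕ
  /-- the stones on the board -/
  stones : HexCell m n → Option Color
  /-- the cells of the 3-terminal region -/
  region : Set (HexCell m n)
  /-- the three black terminals -/
  blackTerminal : Fin 3 → Set (HexVertex m n)
  /-- the three white terminals -/
  whiteTerminal : Fin 3 → Set (HexVertex m n)
  region_connected :
    ((hexGraph m n).induce (Sum.inl '' region : Set (HexVertex m n))).Connected
  compl_connected :
    ((hexGraph m n).induce (Sum.inl '' region : Set (HexVertex m n))ᶜ).Connected
  surrounded : ∀ v ∈ regionBoundary region, vertexColor stones v ≠ none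
  black_components : IsThreeComponents (hexGraph m n)
    {v | v ∈ regionBoundary region ∧ vertexColor stones v = some Color.black} blackTerminal
  white_components : IsThreeComponents (hexGraph m n)
    {v | v ∈ regionBoundary region ∧ vertexColor stones v = some Color.white} whiteTerminal

/-! ### 3-terminal positions and their values -/

/-- The five outcomes of a 3-terminal region. With terminals numbered `0, 1, 2`:
`bot`: no two black terminals are connected; `a`: exactly `1` and `2` are connected;
`b`: exactly `0` and `2` are connected; `c`: exactly `0` and `1` are connected;
`top`: all three are connected. -/
inductive Outcome3
  | bot
  | a
  | b
  | c
  | top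
  deriving DecidableEq

namespace Outcome3

/-- `bot` is the least outcome, `top` the greatest one, and `a`, `b`, `c` are incomparable. -/
instance : PartialOrder Outcome3 where
  le x y := x = bot ∨ y = top ∨ x = y
  le_refl x := Or.inr (Or.inr rfl)
  le_trans x y z := by
    rintro (rfl | rfl | rfl) (h | rfl | rfl) <;> simp_all
  le_antisymm x y := by
    rintro (rfl | rfl | rfl) (h | h | h) <;> simp_all

/-- `x.Links i j`: in outcome `x`, the black terminals `i` and `j` are connected. -/
def Links : Outcome3 → Fin 3 → Fin 3 → Prop
  | bot, i, j => i = j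
  | a, i, j => i = j ∨ (i ≠ 0 ∧ j ≠ 0)
  | b, i, j => i = j ∨ (i ≠ 1 ∧ j ≠ 1)
  | c, i, j => i = j ∨ (i ≠ 2 ∧ j ≠ 2)
  | top, _, _ => True

end Outcome3

/-- A 3-terminal Hex position: the contents of a 3-terminal region of some Hex board. Only the
stones inside the region and on its boundary play a role. -/
abbrev ThreeTerminalPosition : Type := MarkedHexBoard

/-- A Hex context: a position on a Hex board with a hole, the hole being a 3-terminal region. Only
the stones outside of the region play a role. -/
abbrev HexContext : Type := MarkedHexBoard

namespace ThreeTerminalPosition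

/-- The cells of the region. -/
abbrev Cells (G : ThreeTerminalPosition) : Type := {x : HexCell G.m G.n // x ∈ G.region}

/-- The stones in the region. -/
def state (G : ThreeTerminalPosition) : G.Cells → Option Color := fun x => G.stones x.1

/-- The black vertices of the region and its boundary when the region is filled by `f`. -/
def blackSet (G : ThreeTerminalPosition) (f : G.Cells → Color) : Set (HexVertex G.m G.n) :=
  {v | ∃ x : G.Cells, v = Sum.inl x.1 ∧ f x = Color.black} ∪ ⋃ i, G.blackTerminal i

/-- The black terminals `i` and `j` are connected within the region when it is filled by `f`. -/
def Conn (G : ThreeTerminalPosition) (f : G.Cells → Color) (i j : Fin 3) : Prop :=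
  ∃ u ∈ G.blackTerminal i, ∃ v ∈ G.blackTerminal j,
    Relation.ReflTransGen
      (fun x y => (hexGraph G.m G.n).Adj x y ∧ x ∈ G.blackSet f ∧ y ∈ G.blackSet f) u v

/-- The outcome of the region when it is filled by `f`. -/
noncomputable def outcome (G : ThreeTerminalPosition) (f : G.Cells → Color) : Outcome3 :=
  open Classical in
  if G.Conn f 1 2 ∧ G.Conn f 0 2 ∧ G.Conn f 0 1 then Outcome3.top
  else if G.Conn f 1 2 then Outcome3.a
  else if G.Conn f 0 2 then Outcome3.b
  else if G.Conn f 0 1 then Outcome3.c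
  else Outcome3.bot

/-- The game form of a 3-terminal Hex position. -/
noncomputable def form (G : ThreeTerminalPosition) : GameForm Outcome3 :=
  positionForm G.outcome G.state

end ThreeTerminalPosition

/-! ### Contexts and plugging in -/

namespace HexContext

/-- The cells of the context: all cells of the board outside of the hole. -/
abbrev Cells (C : HexContext) : Type := {x : HexCell C.m C.n // x ∉ C.region}

/-- The stones of the context. -/
def state (C : HexContext) : C.Cells → Option Color := fun x => C.stones x.1

/-- The black cells and edges of the context when it is filled by `f`. -/
def blackSet (C : HexContext) (f : C.Cells → Color) : Set (HexVertex C.m C.n) :=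
  {v | (∃ x : C.Cells, v = Sum.inl x.1 ∧ f x = Color.black) ∨
    ∃ e : HexEdge, v = Sum.inr e ∧ e.color = Color.black}

/-- Black wins when the context is filled by `f` and the hole contributes the outcome `x`: Black's
two edges are joined by a path in which each step either leads from a black vertex of the context
to an adjacent one, or passes through the hole from one terminal to a terminal linked to it. -/
def BlackWins (C : HexContext) (f : C.Cells → Color) (x : Outcome3) : Prop :=
  Relation.ReflTransGen
    (fun u v =>
      ((hexGraph C.m C.n).Adj u v ∧ u ∈ C.blackSet f ∧ v ∈ C.blackSet f) ∨
      ∃ i j, x.Links i j ∧ u ∈ C.blackTerminal i ∧ v ∈ C.blackTerminal j)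
    (Sum.inr HexEdge.top) (Sum.inr HexEdge.bottom)

/-- The final result (`true = ⊤` if Black wins, `false = ⊥` if White wins) of the game obtained by
plugging `G` into the hole of `C`, terminal `i` of `G` being identified with terminal `i` of the
hole, when all cells of `G` and `C` are filled by `f`. -/
noncomputable def plugOutcome (C : HexContext) (G : ThreeTerminalPosition)
    (f : ThreeTerminalPosition.Cells G ⊕ HexContext.Cells C → Color) : Bool :=
  open Classical in
  decide (HexContext.BlackWins C (fun x => f (Sum.inr x))
    (ThreeTerminalPosition.outcome G fun x => f (Sum.inl x)))

/-- The game form, over the outcome poset `{⊥, ⊤}`, of `G` plugged into the context `C`. -/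
noncomputable def plug (C : HexContext) (G : ThreeTerminalPosition) : GameForm Bool :=
  positionForm (HexContext.plugOutcome C G)
    (Sum.elim (ThreeTerminalPosition.state G) (HexContext.state C))

end HexContext

-- The value `⊤` cannot be detected by a single context, because a position can fall short of `⊤`
-- while offering Black any of the three single links, with the choice postponed as long as a given
-- context requires. Suppose `C` detects `⊤`. Plugging in a filled position of outcome `⊤`
-- (`blackBoard_form`) shows that Black, moving second, wins `C` when all three terminals are
-- linked. It suffices to find a position without value `⊤` with which Black still wins in `C`.
--
-- Two observations make this possible. A winning path that uses a hole with all terminals linked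
-- can be cut to its first entrance and its last exit, so one of the links `a`, `b`, `c` already
-- suffices (`BlackWins.exists_single`), although which one depends on how the context is filled.
-- And the context has only finitely many empty cells, so Black can use only finitely many
-- additional moves there.
--
-- The position is a row of `4 * k` identical six-cell units below three black rails. Each unit has
-- a first port facing the middle of the row and a second port facing outward. Black wants to pass
-- (link the ports) or to hook (link the first port to the rail); a leak links the second port to
-- the rail. On each side of the middle, the `k` nearer units lie under the middle rail and the `k`
-- farther ones under an outer rail. Hooking one unit on each side, with all units between them
-- passing, links two rails, and the choice of groups realizes any of the three pairs.
--
-- White, moving second, prevents every leak (`safe_strategy`). A hooked unit without a leak does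
-- not pass, so seen from the middle each side reaches at most one rail. Labelling black components
-- by rails, only the labels of the two sides of the middle port are identified, and three rails
-- never become one component (`not_all_linked`). Hence `not_equiv_openBoard_form`.
--
-- Black, moving second, wins the plugged-in game by following the context strategy
-- (`plug_openBoard`). A White move in a unit is either answered there or ignored; an ignored move
-- costs at most one fresh unit, while every unit still passes, and gives Black a free move in the
-- context. So `emptyCount C.state + 2` units per group leave two fresh ones in each group when the
-- context is full (`IsBlackStrategy.postpone`, `Reserve.answer`). Then the required link is known,
-- and two fresh units suffice to force a hook: if White spoils one, Black hooks the other
-- (`linked_strategy`).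
--
-- The passage between strategies and game forms is `isBlackStrategy_le` and
-- `IsBlackStrategy.le_positionForm`.

namespace GameForm

/-- Every game form is below the largest outcome. -/
theorem le_atom_top {A : Type} [PartialOrder A] [OrderTop A] (G : GameForm A) :
    Le G (atom ⊤) ∧ Tri G (atom ⊤) := by
  induction G with
  | atom a =>
    have h : Tri (atom a) (atom (⊤ : A)) := Tri.ofAtom le_top
    exact ⟨Le.intro (fun G' hG' => by cases hG'; exact h) (fun H' hH' => by cases hH'; exact h), h⟩
  | node hι hκ L R ihL ihR =>
    have h : Tri (node hι hκ L R) (atom (⊤ : A)) :=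
      hκ.elim fun k => Tri.ofRight (G' := R k) ⟨k, rfl⟩ (ihR k).1
    exact ⟨Le.intro (fun G' hG' => by obtain ⟨i, rfl⟩ := hG'; exact (ihL i).2)
      (fun H' hH' => by cases hH'; exact h), h⟩

end GameForm

-- Second-player strategies and inequalities of game forms

section SetColoring

variable {X A : Type}

theorem positionForm_of_full [Finite X] (π : (X → Color) → A) {p : X → Option Color}
    (h : ∀ x, p x ≠ none) :
    positionForm π p = GameForm.atom (π fun x => (p x).getD Color.white) := by
  rw [positionForm, dif_neg]
  push Not
  exact h

theorem isLeft_positionForm [Finite X] [DecidableEq X] (π : (X → Color) → A)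
    {p : X → Option Color} {x : X} (hx : p x = none) :
    (positionForm π p).IsLeft (positionForm π (Function.update p x (some Color.black))) := by
  rw [positionForm.eq_1 π p, dif_pos ⟨x, hx⟩]
  refine ⟨⟨x, hx⟩, ?_⟩
  congr!

theorem isRight_positionForm [Finite X] [DecidableEq X] (π : (X → Color) → A)
    {p : X → Option Color} {x : X} (hx : p x = none) :
    (positionForm π p).IsRightOrSelf
      (positionForm π (Function.update p x (some Color.white))) := by
  rw [positionForm.eq_1 π p, dif_pos ⟨x, hx⟩]
  refine ⟨⟨x, hx⟩, ?_⟩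
  congr!

theorem exists_of_isRightOrSelf_positionForm [Finite X] [DecidableEq X] (π : (X → Color) → A)
    {p : X → Option Color} {x : X} (hx : p x = none) {H : GameForm A}
    (hH : (positionForm π p).IsRightOrSelf H) :
    ∃ y, p y = none ∧ H = positionForm π (Function.update p y (some Color.white)) := by
  rw [positionForm, dif_pos ⟨x, hx⟩] at hH
  obtain ⟨y, rfl⟩ := hH
  refine ⟨y.1, y.2, ?_⟩
  congr!

/-- The number of empty cells of a position. -/
noncomputable def emptyCount (p : X → Option Color) : ℕ := {x | p x = none}.ncard

theorem emptyCount_update [Finite X] [DecidableEq X] {p : X → Option Color} {x : X}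
    (hx : p x = none) (c : Color) :
    emptyCount (Function.update p x (some c)) + 1 = emptyCount p := by
  have h : {y | p y = none} = insert x {y | Function.update p x (some c) y = none} := by
    ext y
    by_cases hy : y = x
    · simp [hy, hx]
    · simp [hy, Function.update_of_ne]
  unfold emptyCount
  rw [h, Set.ncard_insert_of_notMem (by simp) (Set.toFinite _)]

theorem emptyCount_eq_zero [Finite X] {p : X → Option Color} (h : ∀ x, p x ≠ none) :
    emptyCount p = 0 := by
  unfold emptyCount
  rw [Set.ncard_eq_zero (Set.toFinite _)]
  ext x
  simp [h x]

/-- A set `I` of positions that Black maintains as the second player: it is stable under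
additional black stones, every white stone can be answered or ignored, and it guarantees
`Goal` once all cells are filled. -/
structure IsBlackStrategy [DecidableEq X] (Goal : (X → Color) → Prop)
    (I : (X → Option Color) → Prop) : Prop where
  mono : ∀ p x, p x = none → I p → I (Function.update p x (some Color.black))
  answer : ∀ p x, p x = none → I p → I (Function.update p x (some Color.white)) ∨
    ∃ y, y ≠ x ∧ p y = none ∧
      I (Function.update (Function.update p x (some Color.white)) y (some Color.black))
  final : ∀ p, (∀ x, p x ≠ none) → I p → Goal fun x => (p x).getD Color.white

/-- A set `I` of positions that White maintains as the second player in order to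
avoid `Goal`. -/
structure IsWhiteStrategy [DecidableEq X] (Goal : (X → Color) → Prop)
    (I : (X → Option Color) → Prop) : Prop where
  mono : ∀ p x, p x = none → I p → I (Function.update p x (some Color.white))
  answer : ∀ p x, p x = none → I p → I (Function.update p x (some Color.black)) ∨
    ∃ y, y ≠ x ∧ p y = none ∧
      I (Function.update (Function.update p x (some Color.black)) y (some Color.white))
  final : ∀ p, (∀ x, p x ≠ none) → I p → ¬ Goal fun x => (p x).getD Color.white

/-- Black and White cannot both achieve their aims. -/
theorem IsBlackStrategy.false_of_isWhiteStrategy [Finite X] [DecidableEq X]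
    {Goal : (X → Color) → Prop} {I J : (X → Option Color) → Prop}
    (hI : IsBlackStrategy Goal I) (hJ : IsWhiteStrategy Goal J) {p : X → Option Color}
    (hp : I p) (hp' : J p) : False := by
  -- The induction always has White to move. Since White may also be allowed to pass, the hypothesis
  -- on `J` covers both a position already in `J` and one that a single White move brings into `J`.
  have key : ∀ n, ∀ p : X → Option Color, emptyCount p = n → I p →
      (J p ∨ ∃ z, p z = none ∧ J (Function.update p z (some Color.white))) → False := by
    intro n
    induction n using Nat.strong_induction_on with
    | _ n ih =>
    intro p hn hI' hJ'
    have step : ∀ z, p z = none → J (Function.update p z (some Color.white)) → False := by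
      intro z hz hJz
      have hc := emptyCount_update hz Color.white
      rcases hI.answer p z hz hI' with h | ⟨y, hyz, hy, h⟩
      · exact ih _ (by omega) _ rfl h (Or.inl hJz)
      · have hy' : Function.update p z (some Color.white) y = none := by
          rwa [Function.update_of_ne hyz]
        have hc' := emptyCount_update hy' Color.black
        refine ih _ (by omega) _ rfl h ?_
        rcases hJ.answer _ y hy' hJz with h' | ⟨w, hwy, hw, h'⟩
        · exact Or.inl h'
        · refine Or.inr ⟨w, ?_, h'⟩
          rwa [Function.update_of_ne hwy]
    rcases hJ' with hJ' | ⟨z, hz, hJz⟩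
    · by_cases hfull : ∀ x, p x ≠ none
      · exact hJ.final p hfull hJ' (hI.final p hfull hI')
      · push Not at hfull
        obtain ⟨z, hz⟩ := hfull
        exact step z hz (hJ.mono p z hz hJ')
    · exact step z hz hJz
  exact key _ p rfl hp (Or.inl hp')

/-- A strategy of Black as second player yields an inequality of game forms. -/
theorem IsBlackStrategy.le_positionForm [Finite X] [DecidableEq X] [PartialOrder A]
    {π : (X → Color) → A} {a : A} {I : (X → Option Color) → Prop}
    (hI : IsBlackStrategy (fun f => a ≤ π f) I) {p : X → Option Color} (hp : I p) :
    GameForm.Le (GameForm.atom a) (positionForm π p) := by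
  -- `Le` is the statement with White to move and `Tri` the one with Black to move. An ignored White
  -- stone leads to the latter, so both are carried through the induction.
  have key : ∀ n, ∀ p : X → Option Color, emptyCount p = n → I p →
      GameForm.Le (GameForm.atom a) (positionForm π p) ∧
        GameForm.Tri (GameForm.atom a) (positionForm π p) := by
    intro n
    induction n using Nat.strong_induction_on with
    | _ n ih =>
    intro p hn hp
    by_cases hfull : ∀ x, p x ≠ none
    · rw [positionForm_of_full π hfull]
      have h := GameForm.Tri.ofAtom (hI.final p hfull hp)
      exact ⟨GameForm.Le.intro (fun G' hG' => by cases hG'; exact h)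
        (fun H' hH' => by cases hH'; exact h), h⟩
    · push Not at hfull
      obtain ⟨z, hz⟩ := hfull
      have hc := emptyCount_update hz Color.black
      have htri : GameForm.Tri (GameForm.atom a) (positionForm π p) :=
        GameForm.Tri.ofLeft (isLeft_positionForm π hz)
          (ih _ (by omega) _ rfl (hI.mono p z hz hp)).1
      refine ⟨GameForm.Le.intro (fun G' hG' => by cases hG'; exact htri) ?_, htri⟩
      intro H' hH'
      obtain ⟨x, hx, rfl⟩ := exists_of_isRightOrSelf_positionForm π hz hH'
      have hc := emptyCount_update hx Color.white
      rcases hI.answer p x hx hp with h | ⟨y, hyx, hy, h⟩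
      · exact (ih _ (by omega) _ rfl h).2
      · have hy' : Function.update p x (some Color.white) y = none := by
          rwa [Function.update_of_ne hyx]
        have hc' := emptyCount_update hy' Color.black
        exact GameForm.Tri.ofLeft (isLeft_positionForm π hy') (ih _ (by omega) _ rfl h).1
  exact (key _ p rfl hp).1

/-- The value of a cell for Black. -/
def cellRank : Option Color → ℕ
  | some Color.white => 0
  | none => 1
  | some Color.black => 2

/-- The position `q` is at least as good for Black as `p`, cell by cell. -/
def Dominates (q p : X → Option Color) : Prop := ∀ x, cellRank (p x) ≤ cellRank (q x)

theorem cellRank_le_update [DecidableEq X] {p q : X → Option Color} (h : Dominates q p) {x : X}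
    {c d : Option Color} (hcd : cellRank c ≤ cellRank d) :
    Dominates (Function.update q x d) (Function.update p x c) := by
  intro y
  by_cases hy : y = x
  · subst hy; simpa using hcd
  · simpa [Function.update_of_ne hy] using h y

theorem Dominates.update_right [DecidableEq X] {p q : X → Option Color} (h : Dominates q p)
    {x : X} {c : Option Color} (hc : cellRank c ≤ cellRank (q x)) :
    Dominates q (Function.update p x c) := by
  intro y
  by_cases hy : y = x
  · subst hy; simpa using hc
  · simpa [Function.update_of_ne hy] using h y

theorem Dominates.update_left [DecidableEq X] {p q : X → Option Color} (h : Dominates q p)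
    {x : X} {d : Option Color} (hd : cellRank (p x) ≤ cellRank d) :
    Dominates (Function.update q x d) p := by
  intro y
  by_cases hy : y = x
  · subst hy; simpa using hd
  · simpa [Function.update_of_ne hy] using h y

theorem cellRank_cases (c : Option Color) :
    (c = some Color.white ∧ cellRank c = 0) ∨ (c = none ∧ cellRank c = 1) ∨
      (c = some Color.black ∧ cellRank c = 2) := by
  rcases c with _ | _ | _ <;> simp [cellRank]

/-- The colorings are ordered by their sets of black cells. -/
def BlackLe (f g : X → Color) : Prop := ∀ x, f x = Color.black → g x = Color.black

theorem blackLe_getD {p q : X → Option Color} (h : Dominates q p)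
    (hp : ∀ x, p x ≠ none) :
    BlackLe (fun x => (p x).getD Color.white) (fun x => (q x).getD Color.white) := by
  intro x hx
  have h1 := h x
  rcases cellRank_cases (p x) with ⟨h2, h3⟩ | ⟨h2, h3⟩ | ⟨h2, h3⟩
  · simp [h2] at hx
  · exact absurd h2 (hp x)
  · rcases cellRank_cases (q x) with ⟨h4, h5⟩ | ⟨h4, h5⟩ | ⟨h4, h5⟩
    · omega
    · omega
    · simp [h4]

/-- An inequality of game forms yields a strategy of Black as second player. -/
theorem isBlackStrategy_le [Finite X] [DecidableEq X] [PartialOrder A] (π : (X → Color) → A)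
    (a : A) (hπ : ∀ f g, BlackLe f g → a ≤ π f → a ≤ π g) :
    IsBlackStrategy (fun f => a ≤ π f) fun q => ∃ p, Dominates q p ∧
      GameForm.Le (GameForm.atom a) (positionForm π p) where
  mono := by
    rintro q x hq ⟨p, hpq, hp⟩
    refine ⟨p, hpq.update_left ?_, hp⟩
    have := hpq x
    rw [hq] at this
    exact this.trans (by simp [cellRank])
  answer := by
    rintro q x hq ⟨p, hpq, hp⟩
    have h1 := hpq x
    rcases cellRank_cases (p x) with ⟨h2, h3⟩ | ⟨h2, h3⟩ | ⟨h2, h3⟩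
    · exact Or.inl ⟨p, hpq.update_left (by simp [h2]), hp⟩
    · obtain ⟨-, hR⟩ := hp
      have h4 := hR _ (isRight_positionForm π h2)
      have hdom : Dominates (Function.update q x (some Color.white))
          (Function.update p x (some Color.white)) := cellRank_le_update hpq le_rfl
      -- If White's stone completes `p`, then `h4` compares two atoms and no reply is required.
      by_cases hfull : ∀ y, Function.update p x (some Color.white) y ≠ none
      · refine Or.inl ⟨_, hdom, ?_⟩
        rw [positionForm_of_full π hfull] at h4 ⊢
        exact GameForm.Le.intro (fun G' hG' => by cases hG'; exact h4)
          (fun H' hH' => by cases hH'; exact h4)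
      · push Not at hfull
        have : ∃ y, y ≠ x ∧ p y = none ∧ GameForm.Le (GameForm.atom a) (positionForm π
            (Function.update (Function.update p x (some Color.white)) y
              (some Color.black))) := by
          obtain ⟨z, hz⟩ := hfull
          generalize hP : positionForm π (Function.update p x (some Color.white)) = P at h4
          cases h4 with
          | ofRight hG h => exact absurd hG (by simp [GameForm.IsRight])
          | ofLeft hH h =>
            rw [← hP, positionForm, dif_pos ⟨z, hz⟩] at hH
            obtain ⟨y, rfl⟩ := hH
            have hyx : y.1 ≠ x := by
              intro hyx
              have := y.2
              rw [hyx] at this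
              simp at this
            refine ⟨y.1, hyx, ?_, ?_⟩
            · have := y.2
              rwa [Function.update_of_ne hyx] at this
            · convert h
          | ofAtom h =>
            rw [positionForm, dif_pos ⟨z, hz⟩] at hP
            cases hP
        obtain ⟨y, hyx, hy, h⟩ := this
        have h5 := hpq y
        rw [hy] at h5
        rcases cellRank_cases (q y) with ⟨h6, h7⟩ | ⟨h6, h7⟩ | ⟨h6, h7⟩
        · rw [h7] at h5; simp [cellRank] at h5
        · exact Or.inr ⟨y, hyx, h6, _, cellRank_le_update hdom le_rfl, h⟩
        -- The better position `q` already has the stone that the strategy for `p` asks for, so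
        -- White's move can be ignored.
        · refine Or.inl ⟨_, hdom.update_right ?_, h⟩
          rw [Function.update_of_ne hyx, h6]
    · rw [hq] at h1
      simp [cellRank, h2] at h1
  final := by
    rintro q hq ⟨p, hpq, hp⟩
    -- The dominated `p` may have empty cells although `q` is full. Following Black's moves in `p`
    -- keeps it below `q`: an empty cell of `p` can only be black in the full position `q`.
    have key : ∀ n, ∀ p : X → Option Color, emptyCount p = n → Dominates q p →
        GameForm.Le (GameForm.atom a) (positionForm π p) →
        a ≤ π fun x => (q x).getD Color.white := by
      intro n
      induction n using Nat.strong_induction_on with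
      | _ n ih =>
      intro p hn hpq hp
      by_cases hfull : ∀ x, p x ≠ none
      · rw [positionForm_of_full π hfull] at hp
        obtain ⟨hL, -⟩ := hp
        have h := hL _ rfl
        cases h with
        | ofRight hG h => exact absurd hG (by simp [GameForm.IsRight])
        | ofLeft hH h => exact absurd hH (by simp [GameForm.IsLeft])
        | ofAtom h => exact hπ _ _ (blackLe_getD hpq hfull) h
      · push Not at hfull
        obtain ⟨z, hz⟩ := hfull
        obtain ⟨hL, -⟩ := hp
        have h4 := hL _ rfl
        generalize hP : positionForm π p = P at h4
        cases h4 with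
        | ofRight hG h => exact absurd hG (by simp [GameForm.IsRight])
        | ofLeft hH h =>
          rw [← hP, positionForm, dif_pos ⟨z, hz⟩] at hH
          obtain ⟨y, rfl⟩ := hH
          have hc := emptyCount_update y.2 Color.black
          refine ih _ (by omega) (Function.update p y.1 (some Color.black)) rfl
            (hpq.update_right ?_) (by convert h)
          have h5 := hpq y.1
          rw [y.2] at h5
          rcases cellRank_cases (q y.1) with ⟨h6, h7⟩ | ⟨h6, h7⟩ | ⟨h6, h7⟩
          · rw [h7] at h5; simp [cellRank] at h5
          · exact absurd h6 (hq y.1)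
          · rw [h6]
        | ofAtom h =>
          rw [positionForm, dif_pos ⟨z, hz⟩] at hP
          cases hP
    exact key _ p rfl hpq hp

end SetColoring

-- Strategies generated by finite lists of positions

section Basis

variable {X : Type}

/-- The positions that are at least as good for Black as one of the positions in `B`. -/
def Above (B : List (X → Option Color)) (s : X → Option Color) : Prop :=
  ∃ t ∈ B, Dominates s t

/-- The positions that are at most as good for Black as one of the positions in `B`. -/
def Below (B : List (X → Option Color)) (s : X → Option Color) : Prop :=
  ∃ t ∈ B, Dominates t s

instance [Fintype X] (p q : X → Option Color) : Decidable (Dominates q p) := by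
  unfold Dominates; infer_instance

instance [Fintype X] (B : List (X → Option Color)) (s : X → Option Color) :
    Decidable (Above B s) := by
  unfold Above; infer_instance

instance [Fintype X] (B : List (X → Option Color)) (s : X → Option Color) :
    Decidable (Below B s) := by
  unfold Below; infer_instance

theorem Dominates.trans {p q r : X → Option Color} (h : Dominates r q) (h' : Dominates q p) :
    Dominates r p := fun x => (h' x).trans (h x)

theorem Above.trans {B : List (X → Option Color)} {s t : X → Option Color} (h : Above B t)
    (hst : Dominates s t) : Above B s := by
  obtain ⟨u, hu, h⟩ := h
  exact ⟨u, hu, hst.trans h⟩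

theorem Below.trans {B : List (X → Option Color)} {s t : X → Option Color} (h : Below B t)
    (hst : Dominates t s) : Below B s := by
  obtain ⟨u, hu, h⟩ := h
  exact ⟨u, hu, h.trans hst⟩

theorem Dominates.refl (p : X → Option Color) : Dominates p p := fun _ => le_rfl

variable [DecidableEq X]

theorem Above.update_black {B : List (X → Option Color)} {s : X → Option Color} (h : Above B s)
    (x : X) : Above B (Function.update s x (some Color.black)) := by
  refine h.trans ((Dominates.refl s).update_left ?_)
  rcases cellRank_cases (s x) with h | h | h <;> simp [cellRank, h]

theorem Below.update_white {B : List (X → Option Color)} {s : X → Option Color} (h : Below B s)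
    (x : X) : Below B (Function.update s x (some Color.white)) :=
  h.trans ((Dominates.refl s).update_right (by simp [cellRank]))

/-- A black stone that improves `t` into `Above B` also improves a better position `s`,
unless `s` already has this stone. -/
theorem Above.of_update_black {B : List (X → Option Color)} {s t : X → Option Color}
    (hst : Dominates s t) {y : X} (hy : t y = none)
    (h : Above B (Function.update t y (some Color.black))) :
    Above B s ∨ s y = none ∧ Above B (Function.update s y (some Color.black)) := by
  have h1 := hst y
  rw [hy] at h1
  rcases cellRank_cases (s y) with ⟨h6, h7⟩ | ⟨h6, h7⟩ | ⟨h6, h7⟩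
  · rw [h7] at h1; simp [cellRank] at h1
  · exact Or.inr ⟨h6, h.trans (cellRank_le_update hst le_rfl)⟩
  · exact Or.inl (h.trans (hst.update_right (by rw [h6])))

theorem Below.of_update_white {B : List (X → Option Color)} {s t : X → Option Color}
    (hst : Dominates t s) {y : X} (hy : t y = none)
    (h : Below B (Function.update t y (some Color.white))) :
    Below B s ∨ s y = none ∧ Below B (Function.update s y (some Color.white)) := by
  have h1 := hst y
  rw [hy] at h1
  rcases cellRank_cases (s y) with ⟨h6, h7⟩ | ⟨h6, h7⟩ | ⟨h6, h7⟩
  · refine Or.inl (h.trans (hst.update_left ?_))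
    rw [h6]
  · exact Or.inr ⟨h6, h.trans (cellRank_le_update hst le_rfl)⟩
  · rw [h7] at h1; simp [cellRank] at h1

/-- Domination transports replies from the list to every better position, which leaves a finite
check on `B`. In `hfin` the empty cells of `t` count as black: a full position dominating `t` must
be black there. -/
theorem isBlackStrategy_above {Goal : (X → Color) → Prop} {B : List (X → Option Color)}
    (hGoal : ∀ f g, BlackLe f g → Goal f → Goal g)
    (hB : ∀ t ∈ B, ∀ x, t x = none → Above B (Function.update t x (some Color.white)) ∨
      ∃ y, y ≠ x ∧ t y = none ∧
        Above B (Function.update (Function.update t x (some Color.white)) y (some Color.black)))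
    (hfin : ∀ t ∈ B, Goal fun x => if t x = some Color.white then Color.white else Color.black) :
    IsBlackStrategy Goal (Above B) where
  mono _ x _ h := h.update_black x
  answer := by
    rintro s x hx ⟨t, ht, hst⟩
    have h1 := hst x
    rcases cellRank_cases (t x) with ⟨h2, h3⟩ | ⟨h2, h3⟩ | ⟨h2, h3⟩
    · exact Or.inl ⟨t, ht, hst.update_left (by simp [h2])⟩
    · have hdom : Dominates (Function.update s x (some Color.white))
          (Function.update t x (some Color.white)) := cellRank_le_update hst le_rfl
      rcases hB t ht x h2 with h | ⟨y, hyx, hy, h⟩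
      · exact Or.inl (h.trans hdom)
      · rcases Above.of_update_black hdom (by rwa [Function.update_of_ne hyx]) h with h | ⟨h, h'⟩
        · exact Or.inl h
        · exact Or.inr ⟨y, hyx, by rwa [Function.update_of_ne hyx] at h, h'⟩
    · rw [hx, h3] at h1
      simp [cellRank] at h1
  final := by
    rintro s hs ⟨t, ht, hst⟩
    refine hGoal _ _ (fun x hx => ?_) (hfin t ht)
    have h1 := hst x
    rcases cellRank_cases (s x) with ⟨h6, h7⟩ | ⟨h6, h7⟩ | ⟨h6, h7⟩
    · rcases cellRank_cases (t x) with ⟨h2, h3⟩ | ⟨h2, h3⟩ | ⟨h2, h3⟩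
      · simp [h2] at hx
      · omega
      · omega
    · exact absurd h6 (hs x)
    · simp [h6]

/-- Color dual of `isBlackStrategy_above`; here the empty cells of `t` count as white at the end. -/
theorem isWhiteStrategy_below {Goal : (X → Color) → Prop} {B : List (X → Option Color)}
    (hGoal : ∀ f g, BlackLe f g → Goal f → Goal g)
    (hB : ∀ t ∈ B, ∀ x, t x = none → Below B (Function.update t x (some Color.black)) ∨
      ∃ y, y ≠ x ∧ t y = none ∧
        Below B (Function.update (Function.update t x (some Color.black)) y (some Color.white)))
    (hfin : ∀ t ∈ B, ¬ Goal fun x => if t x = some Color.black then Color.black else Color.white) :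
    IsWhiteStrategy Goal (Below B) where
  mono _ x _ h := h.update_white x
  answer := by
    rintro s x hx ⟨t, ht, hst⟩
    have h1 := hst x
    rcases cellRank_cases (t x) with ⟨h2, h3⟩ | ⟨h2, h3⟩ | ⟨h2, h3⟩
    · rw [hx, h3] at h1
      simp [cellRank] at h1
    · have hdom : Dominates (Function.update t x (some Color.black))
          (Function.update s x (some Color.black)) := cellRank_le_update hst le_rfl
      rcases hB t ht x h2 with h | ⟨y, hyx, hy, h⟩
      · exact Or.inl (h.trans hdom)
      · rcases Below.of_update_white hdom (by rwa [Function.update_of_ne hyx]) h with h | ⟨h, h'⟩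
        · exact Or.inl h
        · exact Or.inr ⟨y, hyx, by rwa [Function.update_of_ne hyx] at h, h'⟩
    · exact Or.inl ⟨t, ht, hst.update_right (by simp [h2])⟩
  final := by
    rintro s hs ⟨t, ht, hst⟩ hG
    refine hfin t ht (hGoal _ _ (fun x hx => ?_) hG)
    have h1 := hst x
    rcases cellRank_cases (s x) with ⟨h6, h7⟩ | ⟨h6, h7⟩ | ⟨h6, h7⟩
    · simp [h6] at hx
    · exact absurd h6 (hs x)
    · rcases cellRank_cases (t x) with ⟨h2, h3⟩ | ⟨h2, h3⟩ | ⟨h2, h3⟩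
      · omega
      · omega
      · simp [h2]

end Basis

/-! ### The unit -/

/-- The contents of the six cells of a unit, some of which may be empty. -/
abbrev UnitState : Type := Fin 6 → Option Color

/-- In a filled unit, the two ports are linked. -/
def PassGoal (g : Fin 6 → Color) : Prop :=
  g 5 = Color.black ∨ g 4 = Color.black ∨ (g 1 = Color.black ∧ g 3 = Color.black)

/-- In a filled unit, the first port is linked to the rail. -/
def HookGoal (g : Fin 6 → Color) : Prop :=
  g 2 = Color.black ∧ ((g 0 = Color.black ∧ (g 1 = Color.black ∨ g 4 = Color.black)) ∨
    (g 3 = Color.black ∧ (g 1 = Color.black ∨ g 4 = Color.black ∨ g 5 = Color.black)))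

/-- In a filled unit, the second port is linked to the rail. -/
def LeakGoal (g : Fin 6 → Color) : Prop :=
  g 2 = Color.black ∧ (g 3 = Color.black ∨
    (g 0 = Color.black ∧ (g 4 = Color.black ∨ (g 1 = Color.black ∧ g 5 = Color.black))))

instance (g : Fin 6 → Color) : Decidable (PassGoal g) := by unfold PassGoal; infer_instance
instance (g : Fin 6 → Color) : Decidable (HookGoal g) := by unfold HookGoal; infer_instance
instance (g : Fin 6 → Color) : Decidable (LeakGoal g) := by unfold LeakGoal; infer_instance

theorem PassGoal.mono {f g : Fin 6 → Color} (h : BlackLe f g) (hf : PassGoal f) : PassGoal g := by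
  have := fun i => h i
  unfold PassGoal at *
  tauto

theorem HookGoal.mono {f g : Fin 6 → Color} (h : BlackLe f g) (hf : HookGoal f) : HookGoal g := by
  have := fun i => h i
  unfold HookGoal at *
  tauto

theorem LeakGoal.mono {f g : Fin 6 → Color} (h : BlackLe f g) (hf : LeakGoal f) : LeakGoal g := by
  have := fun i => h i
  unfold LeakGoal at *
  tauto

namespace UnitState

/-- A black stone. -/
abbrev bl : Option Color := some Color.black

/-- A white stone. -/
abbrev wh : Option Color := some Color.white

/-- An empty cell. -/
abbrev em : Option Color := none

end UnitState

section Bases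

open UnitState

/-- Positions of a unit in which Black, moving second, links the two ports. -/
def passBasis : List UnitState :=
  [![wh, bl, wh, em, em, wh],
    ![wh, wh, wh, wh, wh, bl],
    ![wh, wh, wh, wh, bl, wh],
    ![wh, bl, wh, em, wh, em],
    ![wh, em, wh, bl, em, wh],
    ![wh, bl, wh, bl, wh, wh],
    ![wh, wh, wh, wh, em, em],
    ![wh, em, wh, bl, wh, em]]

/-- Positions of a unit in which Black, moving second, links the first port to the rail. -/
def hookBasis : List UnitState :=
  [![wh, em, bl, bl, wh, em],
    ![em, wh, bl, em, bl, wh],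
    ![em, em, bl, em, em, wh],
    ![bl, wh, bl, wh, bl, wh],
    ![wh, wh, bl, bl, bl, wh],
    ![bl, bl, bl, wh, wh, wh],
    ![bl, em, bl, wh, em, wh],
    ![em, bl, bl, em, wh, wh],
    ![wh, wh, bl, bl, wh, bl],
    ![wh, em, bl, bl, em, wh],
    ![wh, bl, bl, bl, wh, wh]]

/-- Positions of a unit in which Black, moving first, can link the first port to the rail, and
in which White can prevent this only by letting Black link the two ports. -/
def freshBasis : List UnitState :=
  [![em, em, em, em, em, em],
    ![wh, em, em, bl, wh, em],
    ![wh, wh, em, bl, wh, bl],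
    ![em, wh, em, em, bl, wh],
    ![wh, bl, em, bl, wh, wh]]

/-- Positions of a unit in which White, moving second, keeps the second port
separate from the rail. -/
def safeBasis : List UnitState :=
  [![em, em, em, em, em, em],
    ![em, em, bl, wh, em, em],
    ![bl, em, bl, wh, wh, em],
    ![bl, bl, bl, wh, wh, wh],
    ![wh, bl, bl, wh, bl, bl],
    ![bl, wh, bl, wh, wh, bl],
    ![bl, bl, wh, bl, bl, bl]]

end Bases

/-- The lists are certificates: closure under White's moves and Black's replies, and the goal at the
end, are evaluated on each entry. -/
theorem pass_strategy : IsBlackStrategy PassGoal (Above passBasis) :=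
  isBlackStrategy_above (fun _ _ => PassGoal.mono) (by decide +kernel) (by decide +kernel)

theorem hook_strategy : IsBlackStrategy HookGoal (Above hookBasis) :=
  isBlackStrategy_above (fun _ _ => HookGoal.mono) (by decide +kernel) (by decide +kernel)

/-- The list contains the empty unit, so White can prevent a leak in each unit of an open board
separately. -/
theorem safe_strategy : IsWhiteStrategy LeakGoal (Below safeBasis) :=
  isWhiteStrategy_below (fun _ _ => LeakGoal.mono) (by decide +kernel) (by decide +kernel)

/-- Keeping a hook available never endangers the link between the ports, so a fresh unit needs no
separate care for passing. -/
theorem pass_of_fresh {s : UnitState} (h : Above freshBasis s) : Above passBasis s := by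
  have key : ∀ t ∈ freshBasis, Above passBasis t := by decide +kernel
  obtain ⟨t, ht, hst⟩ := h
  exact (key t ht).trans hst

/-- One tempo turns a fresh unit into a hooked one; the first alternative occurs when the stone
required is already there. -/
theorem hook_of_fresh {s : UnitState} (h : Above freshBasis s) : Above hookBasis s ∨
    ∃ y, s y = none ∧ Above hookBasis (Function.update s y (some Color.black)) := by
  have key : ∀ t ∈ freshBasis, ∃ y, t y = none ∧
      Above hookBasis (Function.update t y (some Color.black)) := by decide +kernel
  obtain ⟨t, ht, hst⟩ := h
  obtain ⟨y, hy, h⟩ := key t ht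
  exact (Above.of_update_black hst hy h).imp_right fun h => ⟨y, h⟩

/-- The source of Black's free moves: a White stone that cannot be answered by restoring freshness
still leaves the unit passing without any answer. -/
theorem fresh_answer {s : UnitState} (h : Above freshBasis s) {x : Fin 6} (hx : s x = none) :
    Above passBasis (Function.update s x (some Color.white)) ∨
      ∃ y, y ≠ x ∧ s y = none ∧ Above freshBasis
        (Function.update (Function.update s x (some Color.white)) y (some Color.black)) := by
  have key : ∀ t ∈ freshBasis, ∀ x, t x = none →
      Above passBasis (Function.update t x (some Color.white)) ∨ ∃ y, y ≠ x ∧ t y = none ∧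
        Above freshBasis (Function.update (Function.update t x (some Color.white)) y
          (some Color.black)) := by decide +kernel
  obtain ⟨t, ht, hst⟩ := h
  have h1 := hst x
  rcases cellRank_cases (t x) with ⟨h2, h3⟩ | ⟨h2, h3⟩ | ⟨h2, h3⟩
  · exact Or.inl ((pass_of_fresh ⟨t, ht, Dominates.refl t⟩).trans
      (hst.update_left (by simp [h2])))
  · have hdom : Dominates (Function.update s x (some Color.white))
        (Function.update t x (some Color.white)) := cellRank_le_update hst le_rfl
    rcases key t ht x h2 with h | ⟨y, hyx, hy, h⟩
    · exact Or.inl (h.trans hdom)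
    · rcases Above.of_update_black hdom (by rwa [Function.update_of_ne hyx]) h with h | ⟨h, h'⟩
      · exact Or.inl (pass_of_fresh h)
      · exact Or.inr ⟨y, hyx, by rwa [Function.update_of_ne hyx] at h, h'⟩
  · rw [hx, h3] at h1
    simp [cellRank] at h1

-- Monotonicity of the outcome of a 3-terminal region

theorem reflTransGen_of_induce_connected {V : Type} {Γ : SimpleGraph V} {S : Set V}
    (hS : (Γ.induce S).Connected) {r : V → V → Prop}
    (hr : ∀ x ∈ S, ∀ y ∈ S, Γ.Adj x y → r x y) {u v : V} (hu : u ∈ S) (hv : v ∈ S) :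
    Relation.ReflTransGen r u v := by
  have h := hS.preconnected ⟨u, hu⟩ ⟨v, hv⟩
  rw [SimpleGraph.reachable_iff_reflTransGen] at h
  exact h.lift Subtype.val fun x y hxy => hr x.1 x.2 y.1 y.2 hxy

theorem reflTransGen_symm {V : Type} {r : V → V → Prop} (hr : ∀ x y, r x y → r y x) {u v : V}
    (h : Relation.ReflTransGen r u v) : Relation.ReflTransGen r v u := by
  induction h with
  | refl => exact .refl
  | tail _ h ih => exact .head (hr _ _ h) ih

theorem Outcome3.le_def {x y : Outcome3} :
    x ≤ y ↔ x = Outcome3.bot ∨ y = Outcome3.top ∨ x = y := Iff.rfl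

instance : OrderTop Outcome3 where
  top := Outcome3.top
  le_top _ := Or.inr (Or.inl rfl)

theorem Outcome3.Links.mono {x y : Outcome3} (h : x ≤ y) {i j : Fin 3} (hx : x.Links i j) :
    y.Links i j := by
  rw [Outcome3.le_def] at h
  rcases h with rfl | rfl | rfl
  · have : i = j := hx
    subst this
    cases y <;> simp [Outcome3.Links]
  · trivial
  · exact hx

namespace ThreeTerminalPosition

variable {G : ThreeTerminalPosition}

/-- Adjacency within the black vertices of a filled 3-terminal position. -/
def BlackStep (G : ThreeTerminalPosition) (f : G.Cells → Color) (x y : HexVertex G.m G.n) : Prop :=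
  (hexGraph G.m G.n).Adj x y ∧ x ∈ G.blackSet f ∧ y ∈ G.blackSet f

theorem BlackStep.symm {f : G.Cells → Color} {x y : HexVertex G.m G.n}
    (h : G.BlackStep f x y) : G.BlackStep f y x :=
  ⟨h.1.symm, h.2.2, h.2.1⟩

theorem Conn.symm {f : G.Cells → Color} {i j : Fin 3} (h : G.Conn f i j) : G.Conn f j i := by
  obtain ⟨u, hu, v, hv, h⟩ := h
  exact ⟨v, hv, u, hu, reflTransGen_symm (fun _ _ => BlackStep.symm) h⟩

/-- The two paths may meet terminal `j` at different vertices; they are joined inside this terminal,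
which is black and connected. -/
theorem Conn.trans {f : G.Cells → Color} {i j l : Fin 3} (h : G.Conn f i j)
    (h' : G.Conn f j l) : G.Conn f i l := by
  obtain ⟨u, hu, v, hv, h⟩ := h
  obtain ⟨u', hu', v', hv', h'⟩ := h'
  refine ⟨u, hu, v', hv', h.trans (Relation.ReflTransGen.trans ?_ h')⟩
  refine reflTransGen_of_induce_connected (G.black_components.2.1 j) ?_ hv hu'
  exact fun x hx y hy hxy => ⟨hxy, Or.inr (Set.mem_iUnion.2 ⟨j, hx⟩),
    Or.inr (Set.mem_iUnion.2 ⟨j, hy⟩)⟩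

theorem blackSet_mono {f g : G.Cells → Color} (h : BlackLe f g) : G.blackSet f ⊆ G.blackSet g := by
  rintro v (⟨x, rfl, hx⟩ | hv)
  · exact Or.inl ⟨x, rfl, h x hx⟩
  · exact Or.inr hv

theorem Conn.mono {f g : G.Cells → Color} (h : BlackLe f g) {i j : Fin 3} (hc : G.Conn f i j) :
    G.Conn g i j := by
  obtain ⟨u, hu, v, hv, hc⟩ := hc
  exact ⟨u, hu, v, hv, hc.lift id fun x y hxy =>
    ⟨hxy.1, blackSet_mono h hxy.2.1, blackSet_mono h hxy.2.2⟩⟩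

theorem outcome_eq_top_iff {f : G.Cells → Color} :
    G.outcome f = Outcome3.top ↔ G.Conn f 1 2 ∧ G.Conn f 0 2 ∧ G.Conn f 0 1 := by
  unfold outcome
  split_ifs <;> simp_all

theorem a_le_outcome_iff {f : G.Cells → Color} : Outcome3.a ≤ G.outcome f ↔ G.Conn f 1 2 := by
  unfold outcome
  rw [Outcome3.le_def]
  split_ifs <;> simp_all

theorem b_le_outcome_iff {f : G.Cells → Color} : Outcome3.b ≤ G.outcome f ↔ G.Conn f 0 2 := by
  have h1 : G.Conn f 1 2 → G.Conn f 0 2 → G.Conn f 0 1 := fun h h' => h'.trans h.symm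
  unfold outcome
  rw [Outcome3.le_def]
  split_ifs <;> simp_all

/-- `outcome` tests the pairs in a fixed order. If an earlier pair is linked as well, transitivity
links all three and the outcome is `top`, so the order of the tests does no harm. -/
theorem c_le_outcome_iff {f : G.Cells → Color} : Outcome3.c ≤ G.outcome f ↔ G.Conn f 0 1 := by
  have h1 : G.Conn f 1 2 → G.Conn f 0 1 → G.Conn f 0 2 := fun h h' => h'.trans h
  have h2 : G.Conn f 0 2 → G.Conn f 0 1 → G.Conn f 1 2 := fun h h' => h'.symm.trans h
  unfold outcome
  rw [Outcome3.le_def]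
  split_ifs <;> (simp_all; try tauto)

theorem outcome_mono {f g : G.Cells → Color} (h : BlackLe f g) : G.outcome f ≤ G.outcome g := by
  generalize hx : G.outcome f = x
  cases x with
  | bot => exact Or.inl rfl
  | a => exact a_le_outcome_iff.2 (Conn.mono h (a_le_outcome_iff.1 hx.ge))
  | b => exact b_le_outcome_iff.2 (Conn.mono h (b_le_outcome_iff.1 hx.ge))
  | c => exact c_le_outcome_iff.2 (Conn.mono h (c_le_outcome_iff.1 hx.ge))
  | top =>
    obtain ⟨h1, h2, h3⟩ := outcome_eq_top_iff.1 hx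
    exact (outcome_eq_top_iff.2 ⟨h1.mono h, h2.mono h, h3.mono h⟩).ge

end ThreeTerminalPosition

-- Winning paths through the hole of a context

namespace HexContext

variable {C : HexContext}

/-- The steps of Black's path in a filled context. -/
def PathStep (C : HexContext) (f : C.Cells → Color) (x : Outcome3) (u v : HexVertex C.m C.n) :
    Prop :=
  ((hexGraph C.m C.n).Adj u v ∧ u ∈ C.blackSet f ∧ v ∈ C.blackSet f) ∨
    ∃ i j, x.Links i j ∧ u ∈ C.blackTerminal i ∧ v ∈ C.blackTerminal j

theorem PathStep.mono {f g : C.Cells → Color} (h : BlackLe f g) {x y : Outcome3} (hxy : x ≤ y)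
    {u v : HexVertex C.m C.n} (huv : C.PathStep f x u v) : C.PathStep g y u v := by
  have hs : C.blackSet f ⊆ C.blackSet g := by
    rintro v (⟨x, rfl, hx⟩ | hv)
    · exact Or.inl ⟨x, rfl, h x hx⟩
    · exact Or.inr hv
  rcases huv with ⟨h1, h2, h3⟩ | ⟨i, j, h1, h2⟩
  · exact Or.inl ⟨h1, hs h2, hs h3⟩
  · exact Or.inr ⟨i, j, h1.mono hxy, h2⟩

theorem BlackWins.mono {f g : C.Cells → Color} (h : BlackLe f g) {x y : Outcome3} (hxy : x ≤ y)
    (hw : C.BlackWins f x) : C.BlackWins g y := by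
  have hw' : Relation.ReflTransGen (C.PathStep f x) (Sum.inr HexEdge.top)
    (Sum.inr HexEdge.bottom) := hw
  exact hw'.lift id fun _ _ => PathStep.mono h hxy

/-- If Black wins when all terminals are linked, then linking two of them suffices. -/
theorem BlackWins.exists_single {f : C.Cells → Color} (hw : C.BlackWins f Outcome3.top) :
    ∃ x, (x = Outcome3.a ∨ x = Outcome3.b ∨ x = Outcome3.c) ∧ C.BlackWins f x := by
  -- Record only the first terminal entered and the last one left. A further passage through the
  -- hole replaces the exit and discards everything between entrance and exit.
  have key : ∀ v, Relation.ReflTransGen (C.PathStep f Outcome3.top) (Sum.inr HexEdge.top) v →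
      Relation.ReflTransGen (C.PathStep f Outcome3.bot) (Sum.inr HexEdge.top) v ∨
      ∃ i j, ∃ u ∈ C.blackTerminal i, ∃ w ∈ C.blackTerminal j,
        Relation.ReflTransGen (C.PathStep f Outcome3.bot) (Sum.inr HexEdge.top) u ∧
        Relation.ReflTransGen (C.PathStep f Outcome3.bot) w v := by
    intro v hv
    induction hv with
    | refl => exact Or.inl .refl
    | @tail v v' _ hstep ih =>
      rcases hstep with hstep | ⟨i, j, -, hi, hj⟩
      · have h : C.PathStep f Outcome3.bot v v' := Or.inl hstep
        rcases ih with ih | ⟨i, j, u, hu, w, hw, h1, h2⟩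
        · exact Or.inl (ih.tail h)
        · exact Or.inr ⟨i, j, u, hu, w, hw, h1, h2.tail h⟩
      · rcases ih with ih | ⟨i', j', u, hu, w, hw, h1, h2⟩
        · exact Or.inr ⟨i, j, v, hi, v', hj, ih, .refl⟩
        · exact Or.inr ⟨i', j, u, hu, v', hj, h1, .refl⟩
  have bot_le : ∀ x, Outcome3.bot ≤ x := fun x => Or.inl rfl
  rcases key _ hw with h | ⟨i, j, u, hu, w, hw, h1, h2⟩
  · exact ⟨Outcome3.a, Or.inl rfl, BlackWins.mono (fun _ h => h) (bot_le _) h⟩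
  · have hx : ∃ x, (x = Outcome3.a ∨ x = Outcome3.b ∨ x = Outcome3.c) ∧ x.Links i j := by
      fin_cases i <;> fin_cases j <;> simp [Outcome3.Links]
    obtain ⟨x, hx, hl⟩ := hx
    have hm : ∀ a b, C.PathStep f Outcome3.bot a b → C.PathStep f x a b :=
      fun _ _ => PathStep.mono (fun _ h => h) (bot_le _)
    exact ⟨x, hx, (h1.lift id hm).trans (.head (Or.inr ⟨i, j, hl, hu, hw⟩) (h2.lift id hm))⟩

theorem top_le_plugOutcome_iff {G : ThreeTerminalPosition}
    {f : ThreeTerminalPosition.Cells G ⊕ HexContext.Cells C → Color} :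
    ⊤ ≤ C.plugOutcome G f ↔
      C.BlackWins (fun x => f (Sum.inr x)) (G.outcome fun x => f (Sum.inl x)) := by
  rw [top_le_iff]
  exact @decide_eq_true_iff _ (Classical.propDecidable _)

theorem plugOutcome_mono {G : ThreeTerminalPosition}
    {f g : ThreeTerminalPosition.Cells G ⊕ HexContext.Cells C → Color} (h : BlackLe f g)
    (hf : ⊤ ≤ C.plugOutcome G f) : ⊤ ≤ C.plugOutcome G g := by
  rw [top_le_plugOutcome_iff] at hf ⊢
  exact BlackWins.mono (fun x => h (Sum.inr x))
    (ThreeTerminalPosition.outcome_mono fun x => h (Sum.inl x)) hf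

end HexContext

/-! ### A family of boards -/

/-- Reachability by steps inside a set of vertices. -/
def ReachIn {V : Type} (Γ : SimpleGraph V) (S : Set V) : V → V → Prop :=
  Relation.ReflTransGen fun x y => Γ.Adj x y ∧ x ∈ S ∧ y ∈ S

theorem induce_connected_of_reachIn {V : Type} {Γ : SimpleGraph V} {S : Set V} {v₀ : V}
    (h₀ : v₀ ∈ S) (h : ∀ v ∈ S, ReachIn Γ S v₀ v) : (Γ.induce S).Connected := by
  have key : ∀ v, ReachIn Γ S v₀ v → ∀ hv : v ∈ S, (Γ.induce S).Reachable ⟨v₀, h₀⟩ ⟨v, hv⟩ := by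
    intro v hr
    induction hr with
    | refl => exact fun _ => .rfl
    | @tail x y _ hxy ih =>
      intro hy
      have : (Γ.induce S).Adj ⟨x, hxy.2.1⟩ ⟨y, hy⟩ := hxy.1
      exact (ih hxy.2.1).trans this.reachable
  have : Nonempty S := ⟨⟨v₀, h₀⟩⟩
  refine ⟨fun u v => ?_⟩
  exact (key _ (h u.1 u.2) u.2).symm.trans (key _ (h v.1 v.2) v.2)

/-- Adjacency of cells in terms of coordinates, in one direction. -/
def CoordRel (i j i' j' : ℕ) : Prop :=
  (i + 1 = i' ∧ j = j') ∨ (i = i' ∧ j + 1 = j') ∨ (i + 1 = i' ∧ j = j' + 1)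

theorem hexGraph_adj_cell {m n : ℕ} {x y : HexCell m n} :
    (hexGraph m n).Adj (Sum.inl x) (Sum.inl y) ↔
      CoordRel x.1 x.2 y.1 y.2 ∨ CoordRel y.1 y.2 x.1 x.2 := by
  simp only [hexGraph, SimpleGraph.fromRel_adj, HexRel, CoordRel]
  constructor
  · exact fun h => h.2
  · refine fun h => ⟨fun hxy => ?_, h⟩
    obtain rfl := Sum.inl_injective hxy
    omega

theorem hexGraph_adj_edge {m n : ℕ} {x : HexCell m n} {e : HexEdge} :
    (hexGraph m n).Adj (Sum.inl x) (Sum.inr e) ↔ HexRel m n (Sum.inl x) (Sum.inr e) := by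
  simp only [hexGraph, SimpleGraph.fromRel_adj]
  constructor
  · rintro ⟨-, h | h⟩
    · exact h
    · exact h.elim
  · exact fun h => ⟨Sum.inl_ne_inr, Or.inl h⟩

theorem hexGraph_adj_edges {m n : ℕ} {e e' : HexEdge} :
    (hexGraph m n).Adj (Sum.inr e) (Sum.inr e') ↔ e.color ≠ e'.color := by
  simp only [hexGraph, SimpleGraph.fromRel_adj, HexRel]
  constructor
  · rintro ⟨-, h | h⟩
    · exact h
    · exact h.symm
  · exact fun h => ⟨fun he => h (by rw [Sum.inr_injective he]), Or.inl h⟩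

theorem reachIn_row {m n : ℕ} {S : Set (HexVertex m n)} (j : Fin n) (a : Fin m) (b : ℕ)
    (hab : a.val ≤ b) (hb : b < m)
    (h : ∀ i : Fin m, a ≤ i → i.val ≤ b → Sum.inl (i, j) ∈ S) :
    ReachIn (hexGraph m n) S (Sum.inl (a, j)) (Sum.inl (⟨b, hb⟩, j)) := by
  induction b, hab using Nat.le_induction with
  | base => exact .refl
  | succ b hab ih =>
    refine (ih (by omega) fun i hi hib => h i hi (by omega)).tail ⟨?_, ?_, ?_⟩
    · rw [hexGraph_adj_cell]
      exact Or.inl (Or.inl ⟨rfl, rfl⟩)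
    · exact h _ hab (by simp)
    · exact h _ (by rw [Fin.le_def]; simp; omega) (by simp)

theorem reachIn_column {m n : ℕ} {S : Set (HexVertex m n)} (i : Fin m) (a : Fin n) (b : ℕ)
    (hab : a.val ≤ b) (hb : b < n)
    (h : ∀ j : Fin n, a ≤ j → j.val ≤ b → Sum.inl (i, j) ∈ S) :
    ReachIn (hexGraph m n) S (Sum.inl (i, a)) (Sum.inl (i, ⟨b, hb⟩)) := by
  induction b, hab using Nat.le_induction with
  | base => exact .refl
  | succ b hab ih =>
    refine (ih (by omega) fun i hi hib => h i hi (by omega)).tail ⟨?_, ?_, ?_⟩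
    · rw [hexGraph_adj_cell]
      exact Or.inl (Or.inr (Or.inl ⟨rfl, rfl⟩))
    · exact h _ hab (by simp)
    · exact h _ (by rw [Fin.le_def]; simp; omega) (by simp)

/-- The parts of a unit: the stones attached to the rail, to the first port and to the second
port, the stones in the middle, and the six variable cells. -/
inductive UnitNode
  | rail
  | first
  | second
  | hub
  | cell (e : Fin 6)
  deriving DecidableEq

/-- The part of a unit in a given column and row; there are white stones in the remaining places.
The first port of a unit is on its right if the unit is oriented to the left, that is, if the
first argument is `true`, and on its left otherwise. -/
def unitNode : Bool → ℕ → ℕ → Option UnitNode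
  | true, 3, 2 => some (.cell 0)
  | true, 5, 2 => some (.cell 1)
  | true, 2, 3 => some (.cell 2)
  | true, 3, 3 => some (.cell 3)
  | true, 4, 3 => some (.cell 4)
  | true, 4, 4 => some (.cell 5)
  | true, 4, 2 => some .hub
  | true, 5, 3 => some .first
  | true, 5, 4 => some .first
  | true, 5, 5 => some .first
  | true, 6, 5 => some .first
  | true, 0, 5 => some .second
  | true, 1, 5 => some .second
  | true, 2, 5 => some .second
  | true, 3, 4 => some .second
  | true, 3, 5 => some .second
  | true, 1, 1 => some .rail
  | true, 1, 2 => some .rail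
  | true, 1, 3 => some .rail
  | false, 1, 2 => some (.cell 0)
  | false, 1, 4 => some (.cell 1)
  | false, 2, 1 => some (.cell 2)
  | false, 2, 2 => some (.cell 3)
  | false, 2, 3 => some (.cell 4)
  | false, 3, 3 => some (.cell 5)
  | false, 1, 3 => some .hub
  | false, 0, 5 => some .first
  | false, 1, 5 => some .first
  | false, 2, 4 => some .first
  | false, 2, 5 => some .first
  | false, 3, 2 => some .second
  | false, 4, 2 => some .second
  | false, 5, 2 => some .second
  | false, 5, 3 => some .second
  | false, 5, 4 => some .second
  | false, 5, 5 => some .second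
  | false, 6, 5 => some .second
  | _, _, _ => none

/-- A cell of a unit is a fixed stone or one of six variable cells. -/
def UnitNode.content : Option UnitNode → Color ⊕ Fin 6
  | none => Sum.inl Color.white
  | some (.cell e) => Sum.inr e
  | some _ => Sum.inl Color.black

/-- The cells of a board with `4 * k` units, the first half of which is oriented to the left. -/
def gridCell (k i j : ℕ) : Color ⊕ Fin 6 :=
  if j = 0 then Sum.inl (if i = 6 * k ∨ i = 18 * k then Color.white else Color.black)
  else UnitNode.content (unitNode (decide (i < 12 * k)) (i % 6) j)

theorem unitNode_six (o : Bool) (c : ℕ) : unitNode o c 6 = none := by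
  unfold unitNode
  split <;> simp_all

/-- The segment of the top row to which column `i` belongs. -/
def railOf (k i : ℕ) : Fin 3 := if i < 6 * k then 0 else if i < 18 * k then 1 else 2

/-- The black terminals: the three segments of the top row. -/
def railTerminal (k : ℕ) (t : Fin 3) : Set (HexVertex (24 * k + 1) 7) :=
  {v | ∃ x, v = Sum.inl x ∧ x.2.val = 0 ∧ x.1.val ≠ 6 * k ∧ x.1.val ≠ 18 * k ∧
    railOf k x.1.val = t}

/-- The white terminals: the two gaps in the top row and the remaining boundary. -/
def gapTerminal (k : ℕ) (t : Fin 3) : Set (HexVertex (24 * k + 1) 7) :=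
  {v | (t = 0 ∧ ∃ x, v = Sum.inl x ∧ x.2.val = 0 ∧ x.1.val = 6 * k) ∨
    (t = 1 ∧ ∃ x, v = Sum.inl x ∧ x.2.val = 0 ∧ x.1.val = 18 * k) ∨
    (t = 2 ∧ ((∃ x, v = Sum.inl x ∧ x.2.val = 6) ∨ v = Sum.inr HexEdge.left ∨
      v = Sum.inr HexEdge.right))}

/-- The rows strictly between the top row and the bottom row. -/
def innerRegion (k : ℕ) : Set (HexCell (24 * k + 1) 7) := {x | 0 < x.2.val ∧ x.2.val < 6}

/-- The stones of the board whose units have contents `s`. -/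
def gridStones (k : ℕ) (s : UnitState) (x : HexCell (24 * k + 1) 7) : Option Color :=
  Sum.elim some s (gridCell k x.1 x.2)

theorem mem_innerRegion_image {k : ℕ} {x : HexCell (24 * k + 1) 7} :
    (Sum.inl x : HexVertex (24 * k + 1) 7) ∈ Sum.inl '' innerRegion k ↔
      0 < x.2.val ∧ x.2.val < 6 := by
  simp [innerRegion]

theorem mem_boundary_cell {k : ℕ} {x : HexCell (24 * k + 1) 7} :
    (Sum.inl x : HexVertex (24 * k + 1) 7) ∈ regionBoundary (innerRegion k) ↔
      x.2.val = 0 ∨ x.2.val = 6 := by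
  have hx := x.2.isLt
  constructor
  · rintro ⟨h, -⟩
    rw [mem_innerRegion_image] at h
    omega
  · intro h
    refine ⟨by rw [mem_innerRegion_image]; omega, ?_⟩
    rcases h with h | h
    · refine ⟨(x.1, ⟨1, by omega⟩), ⟨by simp, by simp⟩, ?_⟩
      rw [hexGraph_adj_cell]
      exact Or.inl (Or.inr (Or.inl ⟨rfl, by simp [h]⟩))
    · refine ⟨(x.1, ⟨5, by omega⟩), ⟨by simp, by simp⟩, ?_⟩
      rw [hexGraph_adj_cell]
      exact Or.inr (Or.inr (Or.inl ⟨rfl, by simp [h]⟩))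

theorem mem_boundary_edge {k : ℕ} {e : HexEdge} :
    (Sum.inr e : HexVertex (24 * k + 1) 7) ∈ regionBoundary (innerRegion k) ↔
      e = HexEdge.left ∨ e = HexEdge.right := by
  constructor
  · rintro ⟨-, x, hx, h⟩
    rw [SimpleGraph.adj_comm, hexGraph_adj_edge] at h
    obtain ⟨h1, h2⟩ := hx
    cases e <;> simp [HexRel] at h ⊢ <;> omega
  · intro h
    refine ⟨by simp, ?_⟩
    rcases h with rfl | rfl
    · refine ⟨(⟨0, by omega⟩, ⟨1, by omega⟩), ⟨by simp, by simp⟩, ?_⟩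
      rw [SimpleGraph.adj_comm, hexGraph_adj_edge]
      simp [HexRel]
    · refine ⟨(⟨24 * k, by omega⟩, ⟨1, by omega⟩), ⟨by simp, by simp⟩, ?_⟩
      rw [SimpleGraph.adj_comm, hexGraph_adj_edge]
      simp [HexRel]

theorem gridStones_top {k : ℕ} {s : UnitState} {x : HexCell (24 * k + 1) 7} (h : x.2.val = 0) :
    gridStones k s x = some (if x.1.val = 6 * k ∨ x.1.val = 18 * k then Color.white
      else Color.black) := by
  simp [gridStones, gridCell, h]

theorem gridStones_bottom {k : ℕ} {s : UnitState} {x : HexCell (24 * k + 1) 7}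
    (h : x.2.val = 6) : gridStones k s x = some Color.white := by
  simp [gridStones, gridCell, h, unitNode_six, UnitNode.content]

theorem innerRegion_connected (k : ℕ) :
    ((hexGraph (24 * k + 1) 7).induce
      (Sum.inl '' innerRegion k : Set (HexVertex (24 * k + 1) 7))).Connected := by
  refine induce_connected_of_reachIn (v₀ := Sum.inl (⟨0, by omega⟩, ⟨1, by omega⟩))
    (mem_innerRegion_image.2 ⟨by simp, by simp⟩) ?_
  rintro _ ⟨⟨i, j⟩, ⟨h1, h2⟩, rfl⟩
  simp only at h1 h2
  refine (reachIn_row ⟨1, by omega⟩ ⟨0, by omega⟩ i.val (Nat.zero_le _) i.isLt ?_).trans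
    (reachIn_column i ⟨1, by omega⟩ j.val h1 j.isLt ?_)
  · intro i _ _
    exact mem_innerRegion_image.2 ⟨by simp, by simp⟩
  · intro j' hj hj'
    rw [Fin.le_def] at hj
    exact mem_innerRegion_image.2 ⟨hj, by simp; omega⟩

/-- The rows outside the region are the top and the bottom row, each adjacent to its own edge of the
board, and the four edges form a cycle. -/
theorem innerRegion_compl_connected (k : ℕ) :
    ((hexGraph (24 * k + 1) 7).induce
      (Sum.inl '' innerRegion k : Set (HexVertex (24 * k + 1) 7))ᶜ).Connected := by
  have he : ∀ e : HexEdge, (Sum.inr e : HexVertex (24 * k + 1) 7) ∈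
      (Sum.inl '' innerRegion k : Set (HexVertex (24 * k + 1) 7))ᶜ := by simp
  have hadj : ∀ e e' : HexEdge, e.color ≠ e'.color → ReachIn (hexGraph (24 * k + 1) 7)
      (Sum.inl '' innerRegion k : Set (HexVertex (24 * k + 1) 7))ᶜ (Sum.inr e) (Sum.inr e') :=
    fun e e' h => .single ⟨hexGraph_adj_edges.2 h, he _, he _⟩
  have htl := hadj HexEdge.top HexEdge.left (by decide)
  have htr := hadj HexEdge.top HexEdge.right (by decide)
  have htb := htl.trans (hadj HexEdge.left HexEdge.bottom (by decide))
  refine induce_connected_of_reachIn (v₀ := Sum.inr HexEdge.top) (he _) ?_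
  rintro (x | e) hv
  · have hv' := hv
    rw [Set.mem_compl_iff, mem_innerRegion_image] at hv'
    have hx := x.2.isLt
    rcases Nat.eq_zero_or_pos x.2.val with h | h
    · refine .single ⟨?_, he _, hv⟩
      rw [SimpleGraph.adj_comm, hexGraph_adj_edge]
      exact h
    · refine htb.tail ⟨?_, he _, hv⟩
      rw [SimpleGraph.adj_comm, hexGraph_adj_edge]
      change x.2.val + 1 = 7
      omega
  · cases e
    · exact .refl
    · exact htb
    · exact htl
    · exact htr

/-- The white gaps at columns `6 * k` and `18 * k` keep cells of different rails at least two
columns apart, while adjacent cells of a row differ by one. -/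
theorem railTerminal_isThreeComponents {k : ℕ} (hk : 0 < k) (s : UnitState) :
    IsThreeComponents (hexGraph (24 * k + 1) 7)
      {v | v ∈ regionBoundary (innerRegion k) ∧
        vertexColor (gridStones k s) v = some Color.black} (railTerminal k) := by
  refine ⟨?_, ?_, ?_⟩
  · ext v
    simp only [Set.mem_iUnion, Set.mem_ofPred_eq, railTerminal]
    constructor
    · rintro ⟨t, x, rfl, h1, h2, h3, -⟩
      refine ⟨mem_boundary_cell.2 (Or.inl h1), ?_⟩
      simp [vertexColor, gridStones_top h1, h2, h3]
    · rintro ⟨h1, h2⟩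
      rcases v with x | e
      · rw [mem_boundary_cell] at h1
        rcases h1 with h1 | h1
        · simp only [vertexColor, gridStones_top h1, Option.some.injEq, ite_eq_right_iff,
            reduceCtorEq, imp_false, not_or] at h2
          exact ⟨_, x, rfl, h1, h2.1, h2.2, rfl⟩
        · simp [vertexColor, gridStones_bottom h1] at h2
      · rw [mem_boundary_edge] at h1
        rcases h1 with rfl | rfl <;> simp [vertexColor, HexEdge.color] at h2
  · have key : ∀ (t : Fin 3) (a : ℕ), (ha : a < 24 * k + 1) → a ≠ 6 * k → a ≠ 18 * k →
        railOf k a = t → (∀ i, i < 24 * k + 1 → i ≠ 6 * k → i ≠ 18 * k → railOf k i = t →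
          a ≤ i ∧ ∀ i', a ≤ i' → i' ≤ i → i' ≠ 6 * k ∧ i' ≠ 18 * k ∧ railOf k i' = t) →
        ((hexGraph (24 * k + 1) 7).induce (railTerminal k t)).Connected := by
      intro t a ha h1 h2 h3 h
      refine induce_connected_of_reachIn (v₀ := Sum.inl (⟨a, ha⟩, 0))
        ⟨_, rfl, rfl, h1, h2, h3⟩ ?_
      rintro _ ⟨⟨i, j⟩, rfl, h4, h5, h6, h7⟩
      obtain ⟨h8, h9⟩ := h i i.isLt h5 h6 h7
      obtain rfl : j = 0 := Fin.ext h4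
      refine reachIn_row 0 ⟨a, ha⟩ i h8 i.isLt fun i' hi hi' => ?_
      exact ⟨_, rfl, rfl, h9 i' hi hi'⟩
    intro t
    fin_cases t
    · refine key 0 0 (by omega) (by omega) (by omega) (by simp [railOf, hk]) ?_
      intro i h1 h2 h3 h4
      have : i < 6 * k := by
        by_contra h
        unfold railOf at h4
        rw [if_neg h] at h4
        split_ifs at h4 <;> exact absurd h4 (by decide)
      refine ⟨Nat.zero_le _, fun i' _ h => ⟨by omega, by omega, ?_⟩⟩
      unfold railOf
      rw [if_pos (by omega)]
    · refine key 1 (6 * k + 1) (by omega) (by omega) (by omega) ?_ ?_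
      · unfold railOf
        rw [if_neg (by omega), if_pos (by omega)]
      intro i h1 h2 h3 h4
      have : 6 * k < i ∧ i < 18 * k := by
        unfold railOf at h4
        split_ifs at h4
        · exact absurd h4 (by decide)
        · omega
        · exact absurd h4 (by decide)
      refine ⟨by omega, fun i' _ h => ⟨by omega, by omega, ?_⟩⟩
      unfold railOf
      rw [if_neg (by omega), if_pos (by omega)]
    · refine key 2 (18 * k + 1) (by omega) (by omega) (by omega) ?_ ?_
      · unfold railOf
        rw [if_neg (by omega), if_neg (by omega)]
      intro i h1 h2 h3 h4
      have : 18 * k < i := by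
        unfold railOf at h4
        split_ifs at h4
        · exact absurd h4 (by decide)
        · exact absurd h4 (by decide)
        · omega
      refine ⟨by omega, fun i' _ h => ⟨by omega, by omega, ?_⟩⟩
      unfold railOf
      rw [if_neg (by omega), if_neg (by omega)]
  · rintro t t' htt' _ ⟨x, rfl, h1, h2, h3, h4⟩ _ ⟨y, rfl, h5, h6, h7, h8⟩
    have hne : railOf k x.1 ≠ railOf k y.1 := by rwa [h4, h8]
    constructor
    · intro h
      rw [Sum.inl_injective h] at hne
      exact hne rfl
    · rw [hexGraph_adj_cell]
      unfold CoordRel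
      unfold railOf at hne
      intro h
      split_ifs at hne <;> first | exact hne rfl | omega

/-- Each gap is a single cell of the top row, away from the side edges because `0 < k`. The bottom
row joins the left and right edges into the third component. -/
theorem gapTerminal_isThreeComponents {k : ℕ} (hk : 0 < k) (s : UnitState) :
    IsThreeComponents (hexGraph (24 * k + 1) 7)
      {v | v ∈ regionBoundary (innerRegion k) ∧
        vertexColor (gridStones k s) v = some Color.white} (gapTerminal k) := by
  refine ⟨?_, ?_, ?_⟩
  · ext v
    simp only [Set.mem_iUnion, Set.mem_ofPred_eq, gapTerminal]
    constructor
    · rintro ⟨t, ⟨-, x, rfl, h1, h2⟩ | ⟨-, x, rfl, h1, h2⟩ | ⟨-, ⟨x, rfl, h1⟩ | rfl | rfl⟩⟩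
      · refine ⟨mem_boundary_cell.2 (Or.inl h1), ?_⟩
        simp [vertexColor, gridStones_top h1, h2]
      · refine ⟨mem_boundary_cell.2 (Or.inl h1), ?_⟩
        simp [vertexColor, gridStones_top h1, h2]
      · refine ⟨mem_boundary_cell.2 (Or.inr h1), ?_⟩
        simp [vertexColor, gridStones_bottom h1]
      · exact ⟨mem_boundary_edge.2 (Or.inl rfl), rfl⟩
      · exact ⟨mem_boundary_edge.2 (Or.inr rfl), rfl⟩
    · rintro ⟨h1, h2⟩
      rcases v with x | e
      · rw [mem_boundary_cell] at h1
        rcases h1 with h1 | h1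
        · simp only [vertexColor, gridStones_top h1, Option.some.injEq] at h2
          split_ifs at h2 with h
          rcases h with h | h
          · exact ⟨0, Or.inl ⟨rfl, x, rfl, h1, h⟩⟩
          · exact ⟨1, Or.inr (Or.inl ⟨rfl, x, rfl, h1, h⟩)⟩
        · exact ⟨2, Or.inr (Or.inr ⟨rfl, Or.inl ⟨x, rfl, h1⟩⟩)⟩
      · rw [mem_boundary_edge] at h1
        exact ⟨2, Or.inr (Or.inr ⟨rfl, Or.inr (by simpa using h1)⟩)⟩
  · have single : ∀ (t : Fin 3) (a : ℕ), (ha : a < 24 * k + 1) →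
        (∀ v, v ∈ gapTerminal k t ↔ ∃ x, v = Sum.inl x ∧ x.2.val = 0 ∧ x.1.val = a) →
        ((hexGraph (24 * k + 1) 7).induce (gapTerminal k t)).Connected := by
      intro t a ha h
      refine induce_connected_of_reachIn (v₀ := Sum.inl (⟨a, ha⟩, 0))
        ((h _).2 ⟨_, rfl, rfl, rfl⟩) ?_
      intro v hv
      obtain ⟨⟨i, j⟩, rfl, h1, h2⟩ := (h v).1 hv
      obtain rfl : i = ⟨a, ha⟩ := Fin.ext h2
      obtain rfl : j = 0 := Fin.ext h1
      exact .refl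
    intro t
    fin_cases t
    · exact single 0 (6 * k) (by omega) fun v => by simp [gapTerminal]
    · exact single 1 (18 * k) (by omega) fun v => by simp [gapTerminal]
    · have hmem : ∀ v, v ∈ gapTerminal k 2 ↔ ((∃ x, v = Sum.inl x ∧ x.2.val = 6) ∨
          v = Sum.inr HexEdge.left ∨ v = Sum.inr HexEdge.right) := fun v => by
        simp [gapTerminal]
      have hl : Sum.inr HexEdge.left ∈ gapTerminal k 2 := (hmem _).2 (Or.inr (Or.inl rfl))
      have hr : Sum.inr HexEdge.right ∈ gapTerminal k 2 := (hmem _).2 (Or.inr (Or.inr rfl))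
      have hc : ∀ i, Sum.inl (i, 6) ∈ gapTerminal k 2 :=
        fun i => (hmem _).2 (Or.inl ⟨_, rfl, rfl⟩)
      have hrow : ∀ i : Fin (24 * k + 1), ReachIn (hexGraph (24 * k + 1) 7) (gapTerminal k 2)
          (Sum.inr HexEdge.left) (Sum.inl (i, 6)) := by
        intro i
        refine Relation.ReflTransGen.head ⟨?_, hl, hc ⟨0, by omega⟩⟩
          (reachIn_row 6 ⟨0, by omega⟩ i (Nat.zero_le _) i.isLt fun i' _ _ => hc i')
        rw [SimpleGraph.adj_comm, hexGraph_adj_edge]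
        simp [HexRel]
      refine induce_connected_of_reachIn hl ?_
      intro v hv
      rcases (hmem v).1 hv with ⟨⟨i, j⟩, rfl, h1⟩ | rfl | rfl
      · obtain rfl : j = 6 := Fin.ext h1
        exact hrow i
      · exact .refl
      · refine (hrow ⟨24 * k, by omega⟩).tail ⟨?_, hc _, hr⟩
        rw [hexGraph_adj_edge]
        simp [HexRel]
  · have key : ∀ t t', t < t' → ∀ u ∈ gapTerminal k t, ∀ v ∈ gapTerminal k t',
        u ≠ v ∧ ¬ (hexGraph (24 * k + 1) 7).Adj u v := by
      rintro t t' htt' _ (⟨rfl, x, rfl, h1, h2⟩ | ⟨rfl, x, rfl, h1, h2⟩ |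
        ⟨rfl, ⟨x, rfl, h1⟩ | rfl | rfl⟩) _ (⟨rfl, y, rfl, h3, h4⟩ | ⟨rfl, y, rfl, h3, h4⟩ |
        ⟨rfl, ⟨y, rfl, h3⟩ | rfl | rfl⟩) <;>
      first
        | exact absurd htt' (by decide)
        | (constructor
           · intro h
             obtain rfl := Sum.inl_injective h
             omega
           · rw [hexGraph_adj_cell]
             unfold CoordRel
             omega)
        | (refine ⟨Sum.inl_ne_inr, ?_⟩
           rw [hexGraph_adj_edge]
           simp only [HexRel]
           omega)
    intro t t' htt' u hu v hv
    rcases lt_or_gt_of_ne htt' with h | h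
    · exact key t t' h u hu v hv
    · obtain ⟨h1, h2⟩ := key t' t h v hv u hu
      exact ⟨h1.symm, fun h => h2 h.symm⟩

/-- The board with `4 * k` units whose contents are `s`. -/
def unitBoard (k : ℕ) (hk : 0 < k) (s : UnitState) : MarkedHexBoard where
  m := 24 * k + 1
  n := 7
  stones := gridStones k s
  region := innerRegion k
  blackTerminal := railTerminal k
  whiteTerminal := gapTerminal k
  region_connected := innerRegion_connected k
  compl_connected := innerRegion_compl_connected k
  surrounded := by
    rintro (x | e) hv
    · rcases mem_boundary_cell.1 hv with h | h
      · simp [vertexColor, gridStones_top h]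
      · simp [vertexColor, gridStones_bottom h]
    · simp [vertexColor]
  black_components := railTerminal_isThreeComponents hk s
  white_components := gapTerminal_isThreeComponents hk s

/-! ### Links in the filled boards -/

/-- The color of a part of a filled unit. -/
def nodeColor (u : Fin 6 → Color) : Option UnitNode → Color
  | none => Color.white
  | some (.cell e) => u e
  | some _ => Color.black

/-- The color of a cell of the board when the units are filled according to `g`. -/
def colorAt (k : ℕ) (g : ℕ → Fin 6 → Color) (i j : ℕ) : Color :=
  Sum.elim id (g (i / 6)) (gridCell k i j)

/-- Steps between adjacent black cells of the filled board. -/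
def CoordStep (k : ℕ) (g : ℕ → Fin 6 → Color) (a b : ℕ × ℕ) : Prop :=
  (CoordRel a.1 a.2 b.1 b.2 ∨ CoordRel b.1 b.2 a.1 a.2) ∧
    (a.1 ≤ 24 * k ∧ a.2 < 7 ∧ colorAt k g a.1 a.2 = Color.black) ∧
    (b.1 ≤ 24 * k ∧ b.2 < 7 ∧ colorAt k g b.1 b.2 = Color.black)

instance (i j i' j' : ℕ) : Decidable (CoordRel i j i' j') := by
  unfold CoordRel; infer_instance

theorem CoordStep.symm {k : ℕ} {g : ℕ → Fin 6 → Color} {a b : ℕ × ℕ} (h : CoordStep k g a b) :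
    CoordStep k g b a :=
  ⟨h.1.symm, h.2.2, h.2.1⟩

theorem elim_content (u : Fin 6 → Color) (n : Option UnitNode) :
    Sum.elim id u (UnitNode.content n) = nodeColor u n := by
  rcases n with _ | _ | _ | _ | _ | _ <;> rfl

/-- Adjacent units share a column, which is column 6 of one and column 0 of the next. Both
descriptions have the same stones whatever the orientations, also at the middle where the
orientation changes. -/
theorem nodeColor_port (u v : Fin 6 → Color) (o o' : Bool) {j : ℕ} (hj : j < 7) :
    nodeColor u (unitNode o 0 j) = nodeColor v (unitNode o' 6 j) := by
  interval_cases j <;> cases o <;> cases o' <;> rfl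

theorem colorAt_unit {k b c j : ℕ} (g : ℕ → Fin 6 → Color) (hc : c ≤ 6) (hj : 0 < j)
    (hj' : j < 7) :
    colorAt k g (6 * b + c) j = nodeColor (g b) (unitNode (decide (b < 2 * k)) c j) := by
  unfold colorAt gridCell
  rw [if_neg hj.ne', elim_content]
  rcases hc.lt_or_eq with hc | rfl
  · rw [show (6 * b + c) / 6 = b by omega, show (6 * b + c) % 6 = c by omega,
      show decide (6 * b + c < 12 * k) = decide (b < 2 * k) from decide_eq_decide.2 (by omega)]
  · rw [show (6 * b + 6) % 6 = 0 by omega]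
    exact nodeColor_port _ _ _ _ hj'

theorem colorAt_top {k i : ℕ} (g : ℕ → Fin 6 → Color) :
    colorAt k g i 0 = Color.black ↔ i ≠ 6 * k ∧ i ≠ 18 * k := by
  simp only [colorAt, gridCell, if_true, Sum.elim_inl, id]
  split_ifs <;> simp_all
  omega

/-- A path of a unit that is black as soon as the variable cells in `E` are black. -/
def goodPath (o : Bool) (E : List (Fin 6)) : List (ℕ × ℕ) → Bool
  | [] => true
  | a :: l =>
    (match a.2 with
      | 0 => decide (1 ≤ a.1 ∧ a.1 ≤ 5)
      | _ => match unitNode o a.1 a.2 with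
        | none => false
        | some (.cell e) => decide (a.1 ≤ 6 ∧ a.2 < 7 ∧ e ∈ E)
        | some _ => decide (a.1 ≤ 6 ∧ a.2 < 7)) &&
    (match l with
      | [] => true
      | b :: _ => decide (CoordRel a.1 a.2 b.1 b.2 ∨ CoordRel b.1 b.2 a.1 a.2)) &&
    goodPath o E l

theorem goodPath.black {k b : ℕ} (hb : b < 4 * k) {g : ℕ → Fin 6 → Color} {E : List (Fin 6)}
    (hE : ∀ e ∈ E, g b e = Color.black) {a : ℕ × ℕ} {l : List (ℕ × ℕ)}
    (h : goodPath (decide (b < 2 * k)) E (a :: l) = true) :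
    6 * b + a.1 ≤ 24 * k ∧ a.2 < 7 ∧ colorAt k g (6 * b + a.1) a.2 = Color.black := by
  obtain ⟨i, j⟩ := a
  simp only [goodPath, Bool.and_eq_true] at h
  obtain ⟨⟨h, -⟩, -⟩ := h
  simp only
  cases j with
  | zero =>
    simp only [decide_eq_true_eq] at h
    refine ⟨by omega, by omega, ?_⟩
    rw [colorAt_top]
    omega
  | succ j =>
    simp only at h
    have key : i ≤ 6 ∧ j + 1 < 7 ∧
        nodeColor (g b) (unitNode (decide (b < 2 * k)) i (j + 1)) = Color.black := by
      cases hn : unitNode (decide (b < 2 * k)) i (j + 1) with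
      | none => rw [hn] at h; simp at h
      | some n =>
        rw [hn] at h
        cases n with
        | cell e =>
          simp only [decide_eq_true_eq] at h
          exact ⟨h.1, h.2.1, hE e h.2.2⟩
        | _ =>
          simp only [decide_eq_true_eq] at h
          exact ⟨h.1, h.2, rfl⟩
    refine ⟨by omega, key.2.1, ?_⟩
    rw [colorAt_unit g key.1 (by omega) key.2.1]
    exact key.2.2

theorem goodPath.reach {k b : ℕ} (hb : b < 4 * k) {g : ℕ → Fin 6 → Color} {E : List (Fin 6)}
    (hE : ∀ e ∈ E, g b e = Color.black) (l : List (ℕ × ℕ)) : ∀ (a : ℕ × ℕ),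
    goodPath (decide (b < 2 * k)) E (a :: l) = true →
    Relation.ReflTransGen (CoordStep k g) (6 * b + a.1, a.2)
      (6 * b + ((a :: l).getLast (List.cons_ne_nil _ _)).1,
        ((a :: l).getLast (List.cons_ne_nil _ _)).2) := by
  induction l with
  | nil => exact fun a _ => .refl
  | cons c l ih =>
    intro a h
    have ha := goodPath.black hb hE h
    have h' := h
    rw [goodPath, Bool.and_eq_true, Bool.and_eq_true, decide_eq_true_eq] at h'
    obtain ⟨⟨-, hrel⟩, h'⟩ := h'
    have hc := goodPath.black hb hE h'
    rw [List.getLast_cons (List.cons_ne_nil _ _)]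
    refine .head ⟨?_, ha, hc⟩ (ih c h')
    unfold CoordRel at hrel ⊢
    simp only
    omega

/-- Along a unit in which the ports are linked, there is a black path. -/
theorem reach_of_passGoal {k b : ℕ} (hb : b < 4 * k) {g : ℕ → Fin 6 → Color}
    (h : PassGoal (g b)) :
    Relation.ReflTransGen (CoordStep k g) (6 * b, 5) (6 * (b + 1), 5) := by
  have key : ∀ (E : List (Fin 6)) (l : List (ℕ × ℕ)), (∀ e ∈ E, g b e = Color.black) →
      goodPath (decide (b < 2 * k)) E ((0, 5) :: (l ++ [(6, 5)])) = true →
      Relation.ReflTransGen (CoordStep k g) (6 * b, 5) (6 * (b + 1), 5) := by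
    intro E l hE hl
    have := goodPath.reach hb hE _ _ hl
    simpa [mul_add] using this
  have h1 : ∀ e, g b e = Color.black → ∀ e' ∈ [e], g b e' = Color.black := by simp
  have h2 : ∀ e e', g b e = Color.black ∧ g b e' = Color.black →
    ∀ e'' ∈ [e, e'], g b e'' = Color.black := by simp
  by_cases ho : b < 2 * k
  · rw [decide_eq_true ho] at key
    rcases h with h | h | h
    · exact key _ [(1, 5), (2, 5), (3, 5), (4, 4), (5, 4), (5, 5)] (h1 _ h) (by decide)
    · exact key _ [(1, 5), (2, 5), (3, 4), (4, 3), (5, 3), (5, 4), (5, 5)] (h1 _ h) (by decide)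
    · exact key _ [(1, 5), (2, 5), (3, 4), (3, 3), (4, 2), (5, 2), (5, 3), (5, 4), (5, 5)]
        (h2 _ _ h) (by decide)
  · rw [decide_eq_false ho] at key
    rcases h with h | h | h
    · exact key _ [(1, 5), (2, 4), (3, 3), (4, 2), (5, 2), (5, 3), (5, 4), (5, 5)] (h1 _ h)
        (by decide)
    · exact key _ [(1, 5), (2, 4), (2, 3), (3, 2), (4, 2), (5, 2), (5, 3), (5, 4), (5, 5)]
        (h1 _ h) (by decide)
    · exact key _ [(1, 4), (1, 3), (2, 2), (3, 2), (4, 2), (5, 2), (5, 3), (5, 4), (5, 5)]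
        (h2 _ _ h) (by decide)

/-- The border of the unit `b` that carries its first port. -/
def firstPort (k b : ℕ) : ℕ := if b < 2 * k then b + 1 else b

/-- In a unit in which the first port is linked to the rail, there is a black path. -/
theorem reach_of_hookGoal {k b : ℕ} (hb : b < 4 * k) {g : ℕ → Fin 6 → Color}
    (h : HookGoal (g b)) :
    ∃ c, 1 ≤ c ∧ c ≤ 5 ∧
      Relation.ReflTransGen (CoordStep k g) (6 * firstPort k b, 5) (6 * b + c, 0) := by
  have key : ∀ (E : List (Fin 6)) (c : ℕ) (l : List (ℕ × ℕ)), (∀ e ∈ E, g b e = Color.black) →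
      goodPath (decide (b < 2 * k)) E
        ((if b < 2 * k then 6 else 0, 5) :: (l ++ [(c, 0)])) = true →
      (1 ≤ c ∧ c ≤ 5) → ∃ c, 1 ≤ c ∧ c ≤ 5 ∧
        Relation.ReflTransGen (CoordStep k g) (6 * firstPort k b, 5) (6 * b + c, 0) := by
    intro E c l hE hl hc
    have := goodPath.reach hb hE _ _ hl
    refine ⟨c, hc.1, hc.2, ?_⟩
    unfold firstPort
    split_ifs at this ⊢ <;> simpa [mul_add] using this
  have h3 : ∀ e e' e'', g b e = Color.black → g b e' = Color.black → g b e'' = Color.black →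
    ∀ x ∈ [e, e', e''], g b x = Color.black := by simp_all
  by_cases ho : b < 2 * k
  · rw [decide_eq_true ho] at key
    simp only [if_pos ho] at key
    rcases h with ⟨h, ⟨h', h'' | h''⟩ | ⟨h', h'' | h'' | h''⟩⟩
    · exact key _ 2 [(5, 5), (5, 4), (5, 3), (5, 2), (4, 2), (3, 2), (2, 3), (1, 3), (1, 2), (1, 1)]
        (h3 _ _ _ h h' h'') (by decide) (by decide)
    · exact key _ 2 [(5, 5), (5, 4), (5, 3), (4, 3), (4, 2), (3, 2), (2, 3), (1, 3), (1, 2), (1, 1)]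
        (h3 _ _ _ h h' h'') (by decide) (by decide)
    · exact key _ 2 [(5, 5), (5, 4), (5, 3), (5, 2), (4, 2), (3, 3), (2, 3), (1, 3), (1, 2), (1, 1)]
        (h3 _ _ _ h h' h'') (by decide) (by decide)
    · exact key _ 2 [(5, 5), (5, 4), (5, 3), (4, 3), (3, 3), (2, 3), (1, 3), (1, 2), (1, 1)]
        (h3 _ _ _ h h' h'') (by decide) (by decide)
    · exact key _ 2 [(5, 5), (5, 4), (4, 4), (3, 4), (3, 3), (2, 3), (1, 3), (1, 2), (1, 1)]
        (h3 _ _ _ h h' h'') (by decide) (by decide)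
  · rw [decide_eq_false ho] at key
    simp only [if_neg ho] at key
    rcases h with ⟨h, ⟨h', h'' | h''⟩ | ⟨h', h'' | h'' | h''⟩⟩
    · exact key _ 3 [(1, 4), (1, 3), (1, 2), (2, 1)]
        (h3 _ _ _ h h' h'') (by decide) (by decide)
    · exact key _ 3 [(1, 5), (2, 4), (2, 3), (1, 3), (1, 2), (2, 1)]
        (h3 _ _ _ h h' h'') (by decide) (by decide)
    · exact key _ 3 [(1, 4), (1, 3), (2, 2), (2, 1)]
        (h3 _ _ _ h h' h'') (by decide) (by decide)
    · exact key _ 3 [(1, 5), (2, 4), (2, 3), (2, 2), (2, 1)]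
        (h3 _ _ _ h h' h'') (by decide) (by decide)
    · exact key _ 3 [(1, 5), (2, 4), (3, 3), (3, 2), (2, 2), (2, 1)]
        (h3 _ _ _ h h' h'') (by decide) (by decide)

/-! ### Separation of the terminals -/

/-- The labels of the parts of a filled unit, given the labels of the rail and of the ports. -/
def nodeLabel (u : Fin 6 → Color) (r p q : Fin 4) : UnitNode → Fin 4
  | .rail => r
  | .first => p
  | .second => q
  | .cell 1 => p
  | .cell 2 => r
  | .cell 3 => q
  | .cell 4 => p
  | .cell 5 => p
  | .cell 0 => if u 2 = Color.black then r else if u 3 = Color.black then q else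
      if u 4 = Color.black ∨ u 1 = Color.black then p else 3
  | .hub => if u 4 = Color.black ∨ u 1 = Color.black then p else if u 3 = Color.black then q else
      if u 0 = Color.black ∧ u 2 = Color.black then r else 3

/-- The pairs of adjacent parts of a unit. -/
def nodeEdges : List (UnitNode × UnitNode) :=
  [(.rail, .cell 2), (.cell 2, .cell 0), (.cell 2, .cell 3), (.cell 0, .hub), (.cell 0, .cell 3),
    (.hub, .cell 3), (.cell 3, .cell 4), (.cell 3, .second), (.cell 1, .hub), (.cell 1, .first),
    (.cell 1, .cell 4), (.cell 4, .first), (.cell 4, .hub), (.cell 4, .second),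
    (.cell 4, .cell 5), (.cell 5, .second), (.cell 5, .first)]

/-- Finite check of the geometry of a unit, with both shared columns included. From here on the
separation argument only uses the abstract graph of parts. -/
theorem nodeEdges_of_coordRel {o : Bool} {c j c' j' : ℕ} (hc : c < 7) (hj : j < 7) (hc' : c' < 7)
    (hj' : j' < 7) (h0 : 0 < j) (h0' : 0 < j') (h : CoordRel c j c' j') {n n' : UnitNode}
    (hn : unitNode o c j = some n) (hn' : unitNode o c' j' = some n') :
    n = n' ∨ (n, n') ∈ nodeEdges ∨ (n', n) ∈ nodeEdges := by
  have key : ∀ o : Bool, ∀ c j c' j' : Fin 7, 0 < j.val → 0 < j'.val →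
      CoordRel c j c' j' → (unitNode o c j).all (fun n => (unitNode o c' j').all fun n' =>
        decide (n = n' ∨ (n, n') ∈ nodeEdges ∨ (n', n) ∈ nodeEdges)) = true := by
    decide +kernel
  simpa [hn, hn'] using key o ⟨c, hc⟩ ⟨j, hj⟩ ⟨c', hc'⟩ ⟨j', hj'⟩ h0 h0' h

/-- The rail is touched only in columns 1 to 5, hence never at a gap, and within one unit these
columns belong to a single rail. -/
theorem rail_of_coordRel {o : Bool} {c c' j : ℕ} (hc : c < 7) (hc' : c' < 7) (hj : j < 7)
    (h0 : 0 < j) (h : CoordRel c 0 c' j ∨ CoordRel c' j c 0) {n : UnitNode}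
    (hn : unitNode o c' j = some n) :
    1 ≤ c ∧ c ≤ 5 ∧ (n = .rail ∨ (.rail, n) ∈ nodeEdges) := by
  have key : ∀ o : Bool, ∀ c c' j : Fin 7, 0 < j.val →
      (CoordRel c 0 c' j ∨ CoordRel c' j c 0) → (unitNode o c' j).all (fun n =>
        decide (1 ≤ c.val ∧ c.val ≤ 5 ∧ (n = .rail ∨ (.rail, n) ∈ nodeEdges))) = true := by
    decide +kernel
  simpa [hn] using key o ⟨c, hc⟩ ⟨c', hc'⟩ ⟨j, hj⟩ h0 h

theorem unitNode_zero : ∀ o : Bool, ∀ j < 7, ∀ n ∈ unitNode o 0 j,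
    n = if o then .second else .first := by
  decide +kernel

theorem unitNode_port : ∀ o : Bool, ∀ j < 7, ∀ n ∈ unitNode o 6 j,
    n = if o then .first else .second := by
  decide +kernel

/-- A unit could merge labels in three ways. A leak is excluded, a hook merges `p` with `r`, and a
pass without a hook merges `p` with `q`. A hook together with a pass would be a leak, so these
equalities are consistent with every black adjacency. -/
theorem nodeLabel_eq {u : Fin 6 → Color} (hu : ¬ LeakGoal u) {r p q : Fin 4}
    (h1 : HookGoal u → p = r) (h2 : ¬ HookGoal u → p = q) {n n' : UnitNode}
    (he : (n, n') ∈ nodeEdges) (hn : nodeColor u (some n) = Color.black)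
    (hn' : nodeColor u (some n') = Color.black) :
    nodeLabel u r p q n = nodeLabel u r p q n' := by
  unfold LeakGoal at hu
  unfold HookGoal at h1 h2
  simp only [nodeEdges, List.mem_cons, Prod.mk.injEq, List.not_mem_nil, or_false] at he
  rcases he with ⟨rfl, rfl⟩ | ⟨rfl, rfl⟩ | ⟨rfl, rfl⟩ | ⟨rfl, rfl⟩ | ⟨rfl, rfl⟩ | ⟨rfl, rfl⟩ |
    ⟨rfl, rfl⟩ | ⟨rfl, rfl⟩ | ⟨rfl, rfl⟩ | ⟨rfl, rfl⟩ | ⟨rfl, rfl⟩ | ⟨rfl, rfl⟩ | ⟨rfl, rfl⟩ |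
    ⟨rfl, rfl⟩ | ⟨rfl, rfl⟩ | ⟨rfl, rfl⟩ | ⟨rfl, rfl⟩ <;>
  simp only [nodeColor, nodeLabel] at hn hn' ⊢ <;> grind

/-- The label of a port: the rail of the last preceding unit that is hooked to its rail. -/
def chainLabel (rail : ℕ → Fin 4) (g : ℕ → Fin 6 → Color) : ℕ → Fin 4
  | 0 => 3
  | n + 1 => if HookGoal (g n) then rail n else chainLabel rail g n

theorem chainLabel_ne {rail : ℕ → Fin 4} {g : ℕ → Fin 6 → Color} {l : Fin 4} (hl : l ≠ 3) {n : ℕ}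
    (h : ∀ m < n, rail m ≠ l) : chainLabel rail g n ≠ l := by
  induction n with
  | zero => exact hl.symm
  | succ n ih =>
    unfold chainLabel
    split_ifs
    · exact h n (by omega)
    · exact ih fun m hm => h m (by omega)

/-- The rail of a unit. -/
def unitRail (k b : ℕ) : Fin 3 := if b < k then 0 else if b < 3 * k then 1 else 2

theorem railOf_unit {k b c : ℕ} (h : 1 ≤ c) (h' : c ≤ 5) : railOf k (6 * b + c) = unitRail k b := by
  unfold railOf unitRail
  split_ifs <;> first | rfl | omega

/-- The label of a port, seen from the left end. -/
def leftLabel (k : ℕ) (g : ℕ → Fin 6 → Color) (b : ℕ) : Fin 4 :=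
  chainLabel (fun b => (unitRail k b).castSucc) g b

/-- The label of a port, seen from the right end. -/
def rightLabel (k : ℕ) (g : ℕ → Fin 6 → Color) (b : ℕ) : Fin 4 :=
  chainLabel (fun n => (unitRail k (4 * k - 1 - n)).castSucc) (fun n => g (4 * k - 1 - n))
    (4 * k - b)

/-- The identification of the two labels of the middle port. -/
def mergeLabel (k : ℕ) (g : ℕ → Fin 6 → Color) (l : Fin 4) : Fin 4 :=
  if l = rightLabel k g (2 * k) then leftLabel k g (2 * k) else l

/-- The label of a port. -/
def portLabel (k : ℕ) (g : ℕ → Fin 6 → Color) (b : ℕ) : Fin 4 :=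
  mergeLabel k g (if b ≤ 2 * k then leftLabel k g b else rightLabel k g b)

theorem leftLabel_succ {k b : ℕ} (g : ℕ → Fin 6 → Color) :
    leftLabel k g (b + 1) =
      if HookGoal (g b) then (unitRail k b).castSucc else leftLabel k g b := rfl

theorem rightLabel_eq {k b : ℕ} (g : ℕ → Fin 6 → Color) (hb : b < 4 * k) :
    rightLabel k g b =
      if HookGoal (g b) then (unitRail k b).castSucc else rightLabel k g (b + 1) := by
  unfold rightLabel
  rw [show 4 * k - b = (4 * k - (b + 1)) + 1 by omega, chainLabel,
    show 4 * k - 1 - (4 * k - (b + 1)) = b by omega]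

theorem portLabel_of_le {k b : ℕ} (g : ℕ → Fin 6 → Color) (hb : b ≤ 2 * k) :
    portLabel k g b = mergeLabel k g (leftLabel k g b) := by
  rw [portLabel, if_pos hb]

/-- At the middle border, where the labels from both sides meet, this is exactly the identification
made by `mergeLabel`. -/
theorem portLabel_of_ge {k b : ℕ} (g : ℕ → Fin 6 → Color) (hb : 2 * k ≤ b) :
    portLabel k g b = mergeLabel k g (rightLabel k g b) := by
  rcases hb.eq_or_lt with rfl | hb
  · rw [portLabel, if_pos le_rfl]
    unfold mergeLabel
    simp
  · rw [portLabel, if_neg (by omega)]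

/-- The border of the unit `b` that carries its second port. -/
def secondPort (k b : ℕ) : ℕ := if b < 2 * k then b else b + 1

/-- One rule for both halves: labels travel towards the middle, from the second port to the first,
and a hook resets them to the rail. -/
theorem portLabel_firstPort {k b : ℕ} (g : ℕ → Fin 6 → Color) (hb : b < 4 * k) :
    portLabel k g (firstPort k b) = if HookGoal (g b) then
      mergeLabel k g (unitRail k b).castSucc else portLabel k g (secondPort k b) := by
  unfold firstPort secondPort
  by_cases h : b < 2 * k
  · simp only [if_pos h]
    rw [portLabel_of_le g (by omega), portLabel_of_le g (by omega), leftLabel_succ]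
    split_ifs <;> rfl
  · simp only [if_neg h]
    rw [portLabel_of_ge g (by omega), portLabel_of_ge g (by omega), rightLabel_eq g hb]
    split_ifs <;> rfl

/-- The label of a cell of the filled board; it is constant on black components. -/
def cellLabel (k : ℕ) (g : ℕ → Fin 6 → Color) (a : ℕ × ℕ) : Fin 4 :=
  if a.2 = 0 then mergeLabel k g (railOf k a.1).castSucc
  else if a.1 % 6 = 0 then portLabel k g (a.1 / 6)
  else match unitNode (decide (a.1 < 12 * k)) (a.1 % 6) a.2 with
    | none => 3
    | some n => nodeLabel (g (a.1 / 6)) (mergeLabel k g (unitRail k (a.1 / 6)).castSucc)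
        (portLabel k g (firstPort k (a.1 / 6))) (portLabel k g (secondPort k (a.1 / 6))) n

theorem cellLabel_unit {k b c j : ℕ} (g : ℕ → Fin 6 → Color) (hc : c ≤ 6) (hj : 0 < j)
    (hj' : j < 7) {n : UnitNode} (hn : unitNode (decide (b < 2 * k)) c j = some n) :
    cellLabel k g (6 * b + c, j) = nodeLabel (g b) (mergeLabel k g (unitRail k b).castSucc)
        (portLabel k g (firstPort k b)) (portLabel k g (secondPort k b)) n := by
  unfold cellLabel
  rw [if_neg (by simpa using hj.ne')]
  simp only
  by_cases h0 : c = 0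
  · subst h0
    rw [if_pos (by omega), show (6 * b + 0) / 6 = b by omega, unitNode_zero _ j hj' n hn]
    unfold firstPort secondPort
    by_cases h : b < 2 * k <;> simp [h, nodeLabel]
  · by_cases h6 : c = 6
    · subst h6
      rw [if_pos (by omega), show (6 * b + 6) / 6 = b + 1 by omega, unitNode_port _ j hj' n hn]
      unfold firstPort secondPort
      by_cases h : b < 2 * k <;> simp [h, nodeLabel]
    · rw [if_neg (by omega), show (6 * b + c) / 6 = b by omega, show (6 * b + c) % 6 = c by omega,
        show decide (6 * b + c < 12 * k) = decide (b < 2 * k) from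
          decide_eq_decide.2 (by omega), hn]

theorem exists_node_of_black {u : Fin 6 → Color} {n : Option UnitNode}
    (h : nodeColor u n = Color.black) :
    ∃ n', n = some n' ∧ nodeColor u (some n') = Color.black := by
  cases n with
  | none => simp [nodeColor] at h
  | some n => exact ⟨n, rfl, h⟩

/-- Two adjacent cells always lie in the columns 0 to 6 of a common unit, so the claim reduces to
the graph of parts, with the top row treated separately. -/
theorem cellLabel_eq_of_coordRel {k : ℕ} {g : ℕ → Fin 6 → Color}
    (hg : ∀ b < 4 * k, ¬ LeakGoal (g b)) {i j i' j' : ℕ} (hrel : CoordRel i j i' j')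
    (hi : i' ≤ 24 * k) (hj : j < 7) (hj' : j' < 7)
    (ha : colorAt k g i j = Color.black) (ha' : colorAt k g i' j' = Color.black) (hk : 0 < k) :
    cellLabel k g (i, j) = cellLabel k g (i', j') := by
  obtain ⟨b, c, c', hb, hc, hc', rfl, rfl⟩ : ∃ b c c', b < 4 * k ∧ c ≤ 6 ∧ c' ≤ 6 ∧
      i = 6 * b + c ∧ i' = 6 * b + c' := by
    have hii : i ≤ i' ∧ i' ≤ i + 1 := by unfold CoordRel at hrel; omega
    by_cases h : i < 24 * k
    · exact ⟨i / 6, i % 6, i' - 6 * (i / 6), by omega, by omega, by omega, by omega, by omega⟩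
    -- The last column starts no unit; it is column 6 of the last one.
    · exact ⟨4 * k - 1, 6, 6, by omega, by omega, by omega, by omega, by omega⟩
  have hrel' : CoordRel c j c' j' := by unfold CoordRel at hrel ⊢; omega
  have h1 : HookGoal (g b) → portLabel k g (firstPort k b) =
      mergeLabel k g (unitRail k b).castSucc := fun h => by
    rw [portLabel_firstPort g hb, if_pos h]
  have h2 : ¬ HookGoal (g b) → portLabel k g (firstPort k b) =
      portLabel k g (secondPort k b) := fun h => by
    rw [portLabel_firstPort g hb, if_neg h]
  have top : ∀ {c c' j}, c ≤ 6 → c' ≤ 6 → 0 < j → j < 7 →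
      (CoordRel c 0 c' j ∨ CoordRel c' j c 0) →
      colorAt k g (6 * b + c') j = Color.black →
      cellLabel k g (6 * b + c, 0) = cellLabel k g (6 * b + c', j) := by
    intro c c' j hc hc' hj hj' hrel h
    rw [colorAt_unit g hc' hj hj'] at h
    obtain ⟨n, hn, hn'⟩ := exists_node_of_black h
    obtain ⟨h3, h4, h5⟩ := rail_of_coordRel (by omega) (by omega) hj' hj hrel hn
    rw [cellLabel_unit g hc' hj hj' hn]
    have h6 : cellLabel k g (6 * b + c, 0) = mergeLabel k g (unitRail k b).castSucc := by
      simp [cellLabel, railOf_unit h3 h4]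
    rw [h6]
    rcases h5 with rfl | h5
    · rfl
    · exact nodeLabel_eq (n := .rail) (hg b hb) h1 h2 h5 rfl hn'
  rcases Nat.eq_zero_or_pos j with rfl | hj0
  · rcases Nat.eq_zero_or_pos j' with rfl | hj0'
    · rw [colorAt_top] at ha ha'
      have : railOf k (6 * b + c) = railOf k (6 * b + c') := by
        unfold CoordRel at hrel
        unfold railOf
        split_ifs <;> first | rfl | omega
      simp [cellLabel, this]
    · exact top hc hc' hj0' hj' (Or.inl hrel') ha'
  · rcases Nat.eq_zero_or_pos j' with rfl | hj0'
    · exact (top hc' hc hj0 hj (Or.inr hrel') ha).symm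
    · rw [colorAt_unit g hc hj0 hj] at ha
      rw [colorAt_unit g hc' hj0' hj'] at ha'
      obtain ⟨n, hn, hnb⟩ := exists_node_of_black ha
      obtain ⟨n', hn', hnb'⟩ := exists_node_of_black ha'
      rw [cellLabel_unit g hc hj0 hj hn, cellLabel_unit g hc' hj0' hj' hn']
      rcases nodeEdges_of_coordRel (by omega) hj (by omega) hj' hj0 hj0' hrel' hn hn'
        with rfl | h | h
      · rfl
      · exact nodeLabel_eq (hg b hb) h1 h2 h hnb hnb'
      · exact (nodeLabel_eq (hg b hb) h1 h2 h hnb' hnb).symm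

theorem cellLabel_eq_of_reach {k : ℕ} (hk : 0 < k) {g : ℕ → Fin 6 → Color}
    (hg : ∀ b < 4 * k, ¬ LeakGoal (g b)) {a a' : ℕ × ℕ}
    (h : Relation.ReflTransGen (CoordStep k g) a a') : cellLabel k g a = cellLabel k g a' := by
  induction h with
  | refl => rfl
  | tail _ h ih =>
    obtain ⟨h | h, ⟨h1, h2, h3⟩, h4, h5, h6⟩ := h
    · exact ih.trans (cellLabel_eq_of_coordRel hg h h4 h2 h5 h3 h6 hk)
    · exact ih.trans (cellLabel_eq_of_coordRel hg h h1 h5 h2 h6 h3 hk).symm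

/-- If no unit links its rail to its second port, then the three rails are not all linked. -/
theorem not_all_linked {k : ℕ} (hk : 0 < k) {g : ℕ → Fin 6 → Color}
    (hg : ∀ b < 4 * k, ¬ LeakGoal (g b)) {i₀ i₁ i₀' i₂ : ℕ} (h₀ : railOf k i₀ = 0)
    (h₁ : railOf k i₁ = 1) (h₀' : railOf k i₀' = 0) (h₂ : railOf k i₂ = 2)
    (h : Relation.ReflTransGen (CoordStep k g) (i₀, 0) (i₁, 0))
    (h' : Relation.ReflTransGen (CoordStep k g) (i₀', 0) (i₂, 0)) : False := by
  have h3 := cellLabel_eq_of_reach hk hg h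
  have h4 := cellLabel_eq_of_reach hk hg h'
  simp only [cellLabel, if_true, h₀, h₁, h₀', h₂] at h3 h4
  have h5 : rightLabel k g (2 * k) ≠ 0 := by
    refine chainLabel_ne (by decide) fun n hn => ?_
    unfold unitRail
    split_ifs
    · omega
    · decide
    · decide
  -- `mergeLabel` replaces one label by another, which cannot make the three rail labels equal.
  unfold mergeLabel at h3 h4
  generalize rightLabel k g (2 * k) = x at *
  generalize leftLabel k g (2 * k) = y at *
  revert h3 h4 h5
  revert x y
  decide

/-! ### Combination of strategies -/

section Combination

variable {X Y Z : Type}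

theorem eq_some_getD {c : Option Color} (h : c ≠ none) : c = some (c.getD Color.white) := by
  cases c with
  | none => exact absurd rfl h
  | some c => rfl

/-- A strategy on some of the cells, when the other cells are full. -/
theorem IsBlackStrategy.extend [DecidableEq X] [DecidableEq Y] {ι : Y → X}
    (hι : Function.Injective ι) {q : X → Option Color} (hq : ∀ x, x ∉ Set.range ι → q x ≠ none)
    {Goal' : (Y → Color) → Prop} {I' : (Y → Option Color) → Prop} {Goal : (X → Color) → Prop}
    (hI : IsBlackStrategy Goal' I')
    (hG : ∀ f, (∀ x, x ∉ Set.range ι → q x = some (f x)) → Goal' (f ∘ ι) → Goal f) :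
    IsBlackStrategy Goal fun p => (∀ x, x ∉ Set.range ι → p x = q x) ∧ I' (p ∘ ι) := by
  have upd : ∀ (p : X → Option Color) y c, (∀ x, x ∉ Set.range ι → p x = q x) →
      ∀ x, x ∉ Set.range ι → Function.update p (ι y) c x = q x := by
    intro p y c hp x hx
    rw [Function.update_of_ne (fun h => hx ⟨y, h.symm⟩)]
    exact hp x hx
  refine ⟨?_, ?_, ?_⟩
  · rintro p x hx ⟨h1, h2⟩
    by_cases hr : x ∈ Set.range ι
    · obtain ⟨y, rfl⟩ := hr
      refine ⟨upd _ _ _ h1, ?_⟩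
      rw [Function.update_comp_eq_of_injective _ hι]
      exact hI.mono _ y hx h2
    · exact absurd ((h1 x hr).symm.trans hx) (hq x hr)
  · rintro p x hx ⟨h1, h2⟩
    by_cases hr : x ∈ Set.range ι
    · obtain ⟨y, rfl⟩ := hr
      rcases hI.answer _ y hx h2 with h | ⟨z, hzy, hz, h⟩
      · refine Or.inl ⟨upd _ _ _ h1, ?_⟩
        rwa [Function.update_comp_eq_of_injective _ hι]
      · refine Or.inr ⟨ι z, hι.ne hzy, hz, upd _ _ _ (upd _ _ _ h1), ?_⟩
        rwa [Function.update_comp_eq_of_injective _ hι, Function.update_comp_eq_of_injective _ hι]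
    · exact absurd ((h1 x hr).symm.trans hx) (hq x hr)
  · rintro p hp ⟨h1, h2⟩
    refine hG _ (fun x hx => ?_) (hI.final _ (fun y => hp (ι y)) h2)
    rw [← h1 x hx]
    exact eq_some_getD (hp x)

theorem IsWhiteStrategy.extend [DecidableEq X] [DecidableEq Y] {ι : Y → X}
    (hι : Function.Injective ι) {q : X → Option Color} (hq : ∀ x, x ∉ Set.range ι → q x ≠ none)
    {Goal' : (Y → Color) → Prop} {I' : (Y → Option Color) → Prop} {Goal : (X → Color) → Prop}
    (hI : IsWhiteStrategy Goal' I')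
    (hG : ∀ f, (∀ x, x ∉ Set.range ι → q x = some (f x)) → Goal f → Goal' (f ∘ ι)) :
    IsWhiteStrategy Goal fun p => (∀ x, x ∉ Set.range ι → p x = q x) ∧ I' (p ∘ ι) := by
  have upd : ∀ (p : X → Option Color) y c, (∀ x, x ∉ Set.range ι → p x = q x) →
      ∀ x, x ∉ Set.range ι → Function.update p (ι y) c x = q x := by
    intro p y c hp x hx
    rw [Function.update_of_ne (fun h => hx ⟨y, h.symm⟩)]
    exact hp x hx
  refine ⟨?_, ?_, ?_⟩
  · rintro p x hx ⟨h1, h2⟩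
    by_cases hr : x ∈ Set.range ι
    · obtain ⟨y, rfl⟩ := hr
      refine ⟨upd _ _ _ h1, ?_⟩
      rw [Function.update_comp_eq_of_injective _ hι]
      exact hI.mono _ y hx h2
    · exact absurd ((h1 x hr).symm.trans hx) (hq x hr)
  · rintro p x hx ⟨h1, h2⟩
    by_cases hr : x ∈ Set.range ι
    · obtain ⟨y, rfl⟩ := hr
      rcases hI.answer _ y hx h2 with h | ⟨z, hzy, hz, h⟩
      · refine Or.inl ⟨upd _ _ _ h1, ?_⟩
        rwa [Function.update_comp_eq_of_injective _ hι]
      · refine Or.inr ⟨ι z, hι.ne hzy, hz, upd _ _ _ (upd _ _ _ h1), ?_⟩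
        rwa [Function.update_comp_eq_of_injective _ hι, Function.update_comp_eq_of_injective _ hι]
    · exact absurd ((h1 x hr).symm.trans hx) (hq x hr)
  · rintro p hp ⟨h1, h2⟩ hgoal
    refine hI.final _ (fun y => hp (ι y)) h2 (hG _ (fun x hx => ?_) hgoal)
    rw [← h1 x hx]
    exact eq_some_getD (hp x)

/-- A strategy restricts to the right-hand cells when the left-hand cells are full. -/
theorem IsBlackStrategy.restrict [DecidableEq X] [DecidableEq Y] {g : X → Option Color}
    (hg : ∀ x, g x ≠ none) {Goal : (X ⊕ Y → Color) → Prop} {I : (X ⊕ Y → Option Color) → Prop}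
    (hI : IsBlackStrategy Goal I) :
    IsBlackStrategy (fun f => Goal (Sum.elim (fun x => (g x).getD Color.white) f))
      fun p => I (Sum.elim g p) where
  mono p y hy h := by
    rw [← Sum.update_elim_inr]
    exact hI.mono _ _ hy h
  answer p y hy h := by
    rcases hI.answer _ (Sum.inr y) hy h with h | ⟨z, hzy, hz, h⟩
    · left
      rwa [← Sum.update_elim_inr]
    · rcases z with x | z
      · exact absurd hz (hg x)
      · refine Or.inr ⟨z, fun h => hzy (by rw [h]), hz, ?_⟩
        rwa [← Sum.update_elim_inr, ← Sum.update_elim_inr]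
  final p hp h := by
    have := hI.final _ (by rintro (x | y); exacts [hg x, hp y]) h
    convert this using 1
    funext z
    rcases z with x | y <;> rfl

variable {K : Type} [DecidableEq K]

theorem update_fiber [DecidableEq Z] (p : K × Z → Option Color) (k k' : K) (z : Z)
    (c : Option Color) :
    (fun w => Function.update p (k, z) c (k', w)) =
      if k' = k then Function.update (fun w => p (k, w)) z c else fun w => p (k', w) := by
  funext w
  by_cases hk : k' = k
  · subst hk
    by_cases hw : w = z
    · subst hw; simp
    · rw [Function.update_of_ne (by simp [hw])]; simp [hw]
  · rw [Function.update_of_ne (by simp [hk])]; simp [hk]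

/-- Independent strategies on disjoint sets of cells. -/
theorem IsBlackStrategy.pi [DecidableEq Z] {Goal : K → (Z → Color) → Prop}
    {I : K → (Z → Option Color) → Prop} (hI : ∀ k, IsBlackStrategy (Goal k) (I k)) :
    IsBlackStrategy (fun f : K × Z → Color => ∀ k, Goal k fun z => f (k, z))
      fun p => ∀ k, I k fun z => p (k, z) where
  mono p x hx h k := by
    rw [update_fiber]
    split_ifs with hk
    · rw [hk]; exact (hI _).mono _ _ hx (h _)
    · exact h k
  answer := by
    rintro p ⟨k₀, z⟩ hx h
    rcases (hI k₀).answer _ z hx (h k₀) with h' | ⟨w, hwz, hw, h'⟩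
    · left
      intro k
      rw [update_fiber]
      split_ifs with hk
      · rwa [hk]
      · exact h k
    · refine Or.inr ⟨(k₀, w), by simp [hwz], hw, fun k => ?_⟩
      rw [update_fiber]
      split_ifs with hk
      · rw [hk, update_fiber, if_pos rfl]; exact h'
      · rw [update_fiber, if_neg hk]; exact h k
  final p hp h k := (hI k).final _ (fun z => hp (k, z)) (h k)

/-- White answers in the component where Black has just moved, and so avoids all the goals at once.
-/
theorem IsWhiteStrategy.pi [DecidableEq Z] {Goal : K → (Z → Color) → Prop}
    {I : K → (Z → Option Color) → Prop} (hI : ∀ k, IsWhiteStrategy (Goal k) (I k)) :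
    IsWhiteStrategy (fun f : K × Z → Color => ∃ k, Goal k fun z => f (k, z))
      fun p => ∀ k, I k fun z => p (k, z) where
  mono p x hx h k := by
    rw [update_fiber]
    split_ifs with hk
    · rw [hk]; exact (hI _).mono _ _ hx (h _)
    · exact h k
  answer := by
    rintro p ⟨k₀, z⟩ hx h
    rcases (hI k₀).answer _ z hx (h k₀) with h' | ⟨w, hwz, hw, h'⟩
    · left
      intro k
      rw [update_fiber]
      split_ifs with hk
      · rwa [hk]
      · exact h k
    · refine Or.inr ⟨(k₀, w), by simp [hwz], hw, fun k => ?_⟩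
      rw [update_fiber]
      split_ifs with hk
      · rw [hk, update_fiber, if_pos rfl]; exact h'
      · rw [update_fiber, if_neg hk]; exact h k
  final p hp h := by
    rintro ⟨k, hk⟩
    exact (hI k).final _ (fun z => hp (k, z)) (h k) hk

/-- The play on `Y` decides which of the goals on `Z` Black has to achieve; up to then, Black
may answer a move of White on `Z` by a move on `Y`. -/
theorem IsBlackStrategy.postpone [Finite Y] [DecidableEq Z] [DecidableEq Y] {T : Type}
    {Goal : (Y → Color) → Prop} {I : (Y → Option Color) → Prop} (hI : IsBlackStrategy Goal I)
    {GoalZ : T → (Z → Color) → Prop} {J : T → (Z → Option Color) → Prop}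
    (hJ : ∀ t, IsBlackStrategy (GoalZ t) (J t)) {R : (Y → Color) → T → Prop}
    (hR : ∀ f, Goal f → ∃ t, R f t) {P : ℕ → (Z → Option Color) → Prop}
    (hPJ : ∀ q t, P 0 q → J t q) (hP : ∀ n q, P (n + 1) q → P n q)
    (hPmono : ∀ n q z, q z = none → P n q → P n (Function.update q z (some Color.black)))
    (hPanswer : ∀ n q z, q z = none → P (n + 1) q → P n (Function.update q z (some Color.white)) ∨
      ∃ w, w ≠ z ∧ q w = none ∧
        P (n + 1) (Function.update (Function.update q z (some Color.white)) w (some Color.black))) :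
    IsBlackStrategy (fun f : Z ⊕ Y → Color => ∃ t, R (f ∘ Sum.inr) t ∧ GoalZ t (f ∘ Sum.inl))
      fun p => (I (p ∘ Sum.inr) ∧ P (emptyCount (p ∘ Sum.inr)) (p ∘ Sum.inl)) ∨
        ((∀ y, p (Sum.inr y) ≠ none) ∧ ∃ t, R (fun y => (p (Sum.inr y)).getD Color.white) t ∧
          J t (p ∘ Sum.inl)) := by
  -- Once `Y` is full the reserve has index 0, and the finished play on `Y` tells which `t` to aim
  -- for.
  have full : ∀ p : Z ⊕ Y → Option Color, (∀ y, p (Sum.inr y) ≠ none) → I (p ∘ Sum.inr) →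
      P (emptyCount (p ∘ Sum.inr)) (p ∘ Sum.inl) →
      ∃ t, R (fun y => (p (Sum.inr y)).getD Color.white) t ∧ J t (p ∘ Sum.inl) := by
    intro p hp h1 h2
    rw [emptyCount_eq_zero (p := p ∘ Sum.inr) hp] at h2
    obtain ⟨t, ht⟩ := hR _ (hI.final _ hp h1)
    exact ⟨t, ht, hPJ _ _ h2⟩
  refine ⟨?_, ?_, ?_⟩
  · rintro p (z | y) hx (⟨h1, h2⟩ | ⟨h1, t, h2, h3⟩)
    · left
      rw [Sum.update_inl_comp_inr, Sum.update_inl_comp_inl]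
      exact ⟨h1, hPmono _ _ z hx h2⟩
    · right
      simp only [Sum.update_inl_apply_inr]
      rw [Sum.update_inl_comp_inl]
      exact ⟨h1, t, h2, (hJ t).mono _ z hx h3⟩
    · left
      rw [Sum.update_inr_comp_inr, Sum.update_inr_comp_inl]
      refine ⟨hI.mono _ y hx h1, hP _ _ ?_⟩
      rwa [emptyCount_update (p := p ∘ Sum.inr) hx]
    · exact absurd hx (h1 y)
  · have late : ∀ (p : Z ⊕ Y → Option Color) (z : Z) (c : Option Color),
        (∀ y, p (Sum.inr y) ≠ none) → ∀ t, R (fun y => (p (Sum.inr y)).getD Color.white) t →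
        J t (Function.update (p ∘ Sum.inl) z c) →
        ((∀ y, Function.update p (Sum.inl z) c (Sum.inr y) ≠ none) ∧ ∃ t,
          R (fun y => (Function.update p (Sum.inl z) c (Sum.inr y)).getD Color.white) t ∧
          J t (Function.update p (Sum.inl z) c ∘ Sum.inl)) := by
      intro p z c h1 t h2 h3
      simp only [Sum.update_inl_apply_inr]
      rw [Sum.update_inl_comp_inl]
      exact ⟨h1, t, h2, h3⟩
    rintro p (z | y) hx h
    · by_cases hfull : ∀ y, p (Sum.inr y) ≠ none
      · have h' : ∃ t, R (fun y => (p (Sum.inr y)).getD Color.white) t ∧ J t (p ∘ Sum.inl) := by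
          rcases h with ⟨h1, h2⟩ | ⟨-, h⟩
          · exact full p hfull h1 h2
          · exact h
        obtain ⟨t, h2, h3⟩ := h'
        rcases (hJ t).answer _ z hx h3 with h | ⟨w, hwz, hw, h⟩
        · exact Or.inl (Or.inr (late p z _ hfull t h2 h))
        · refine Or.inr ⟨Sum.inl w, by simpa using hwz, hw, Or.inr (late _ w _ ?_ t ?_ ?_)⟩
          · simpa using hfull
          · simpa using h2
          · rwa [Sum.update_inl_comp_inl]
      · obtain ⟨h1, h2⟩ := h.resolve_right fun h => hfull h.1
        push Not at hfull
        obtain ⟨y₀, hy₀⟩ := hfull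
        have hcount := emptyCount_update (p := p ∘ Sum.inr) hy₀ Color.black
        rw [← hcount] at h2
        rcases hPanswer _ _ z hx h2 with h | ⟨w, hwz, hw, h⟩
        -- White's stone on `Z` lowers the reserve by one. Black uses the free tempo on an arbitrary
        -- empty cell of `Y`, which lowers the count of empty cells by one as well.
        · refine Or.inr ⟨Sum.inr y₀, by simp, hy₀, Or.inl ?_⟩
          rw [Sum.update_inr_comp_inr, Sum.update_inr_comp_inl, Sum.update_inl_comp_inr,
            Sum.update_inl_comp_inl]
          exact ⟨hI.mono _ _ hy₀ h1, h⟩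
        · refine Or.inr ⟨Sum.inl w, by simpa using hwz, hw, Or.inl ?_⟩
          rw [Sum.update_inl_comp_inr, Sum.update_inl_comp_inr, Sum.update_inl_comp_inl,
            Sum.update_inl_comp_inl, ← hcount]
          exact ⟨h1, h⟩
    · obtain ⟨h1, h2⟩ := h.resolve_right fun h => h.1 y hx
      have hcount := emptyCount_update (p := p ∘ Sum.inr) hx Color.white
      rw [← hcount] at h2
      rcases hI.answer _ y hx h1 with h | ⟨w, hwy, hw, h⟩
      · refine Or.inl (Or.inl ?_)
        rw [Sum.update_inr_comp_inr, Sum.update_inr_comp_inl]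
        exact ⟨h, hP _ _ h2⟩
      · refine Or.inr ⟨Sum.inr w, by simpa using hwy, hw, Or.inl ?_⟩
        rw [Sum.update_inr_comp_inr, Sum.update_inr_comp_inr, Sum.update_inr_comp_inl,
          Sum.update_inr_comp_inl]
        have hw' : Function.update (p ∘ Sum.inr) y (some Color.white) w = none := by
          rwa [Function.update_of_ne hwy]
        have hcount' := emptyCount_update hw' Color.black
        rw [← hcount'] at h2
        -- Two cells of `Y` have been filled and none of `Z`, so the reserve is larger than needed
        -- by two.
        exact ⟨h, hP _ _ (hP _ _ h2)⟩
  · rintro p hp h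
    have h' : ∃ t, R (fun y => (p (Sum.inr y)).getD Color.white) t ∧ J t (p ∘ Sum.inl) := by
      rcases h with ⟨h1, h2⟩ | ⟨-, h⟩
      · exact full p (fun y => hp _) h1 h2
      · exact h
    obtain ⟨t, h1, h2⟩ := h'
    exact ⟨t, h1, (hJ t).final _ (fun z => hp _) h2⟩

end Combination

/-! ### Strategies on a chain of units -/

section Chain

set_option linter.unusedSectionVars false

variable {B K : Type} [LinearOrder B]

/-- Some unit of the group `κ` links its first port to the rail, and the ports of all units
before it are linked. -/
def ChainGoal (grp : B → K) (κ : K) (f : B × Fin 6 → Color) : Prop :=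
  ∃ b, grp b = κ ∧ HookGoal (fun e => f (b, e)) ∧ ∀ b' < b, PassGoal fun e => f (b', e)

/-- Black, moving second, links the first port of the unit `b` to the rail, and the ports of all
units before it. -/
def Hooked (b : B) (q : B × Fin 6 → Option Color) : Prop :=
  ∀ b', (b' = b → Above hookBasis fun e => q (b', e)) ∧
    (b' < b → Above passBasis fun e => q (b', e))

/-- Independent local strategies: hook in unit `b`, pass in the units before it, and no goal at all
beyond it. -/
theorem hooked_strategy (b : B) : IsBlackStrategy
    (fun f => ∀ b', (b' = b → HookGoal fun e => f (b', e)) ∧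
      (b' < b → PassGoal fun e => f (b', e))) (Hooked b) := by
  refine IsBlackStrategy.pi (Goal := fun b' u => (b' = b → HookGoal u) ∧ (b' < b → PassGoal u))
    (I := fun b' u => (b' = b → Above hookBasis u) ∧ (b' < b → Above passBasis u)) fun b' => ?_
  by_cases h1 : b' = b
  · have h2 : ¬ b' < b := h1 ▸ lt_irrefl _
    simpa only [h1, lt_irrefl, true_imp_iff, false_imp_iff, and_true] using hook_strategy
  · by_cases h2 : b' < b
    · simpa only [h1, h2, true_imp_iff, false_imp_iff, true_and] using pass_strategy
    · simp only [h1, h2, false_imp_iff, and_true]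
      exact ⟨fun _ _ _ h => h, fun _ _ _ h => Or.inl h, fun _ _ h => h⟩

/-- Positions of a chain in which Black, moving second, achieves `ChainGoal grp κ`. -/
def Linked (grp : B → K) (κ : K) (q : B × Fin 6 → Option Color) : Prop :=
  (∃ b, grp b = κ ∧ Hooked b q) ∨ ((∀ b, Above passBasis fun e => q (b, e)) ∧
    ∃ b b', b ≠ b' ∧ (grp b = κ ∧ Above freshBasis fun e => q (b, e)) ∧
      (grp b' = κ ∧ Above freshBasis fun e => q (b', e)))

theorem Hooked.of_pass {b : B} {q : B × Fin 6 → Option Color}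
    (hq : ∀ b, Above passBasis fun e => q (b, e)) (hb : Above hookBasis fun e => q (b, e)) :
    Hooked b q := fun b' => ⟨fun h => h ▸ hb, fun _ => hq b'⟩

theorem above_update_black {B' : List UnitState} {q : B × Fin 6 → Option Color} {b : B}
    (h : Above B' fun e => q (b, e)) (x : B × Fin 6) :
    Above B' fun e => Function.update q x (some Color.black) (b, e) := by
  obtain ⟨b₀, e⟩ := x
  rw [update_fiber]
  split_ifs with hb
  · subst hb; exact h.update_black e
  · exact h

/-- Black need not commit to a unit in advance. With two fresh units in the group, White can spoil
one of them only by a move that Black may ignore, and Black then uses the tempo to hook the other;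
all units continue to pass. -/
theorem linked_strategy (grp : B → K) (κ : K) :
    IsBlackStrategy (ChainGoal grp κ) (Linked grp κ) where
  mono := by
    rintro q x hx (⟨b, hb, h⟩ | ⟨h, b, b', hbb', ⟨h1, h2⟩, ⟨h3, h4⟩⟩)
    · exact Or.inl ⟨b, hb, (hooked_strategy b).mono q x hx h⟩
    · exact Or.inr ⟨fun b => above_update_black (h b) x, b, b', hbb',
        ⟨h1, above_update_black h2 x⟩, ⟨h3, above_update_black h4 x⟩⟩
  answer := by
    rintro q x hx (⟨b, hb, h⟩ | ⟨h, b, b', hbb', h1, h2⟩)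
    · rcases (hooked_strategy b).answer q x hx h with h' | ⟨y, hyx, hy, h'⟩
      · exact Or.inl (Or.inl ⟨b, hb, h'⟩)
      · exact Or.inr ⟨y, hyx, hy, Or.inl ⟨b, hb, h'⟩⟩
    · have pass : IsBlackStrategy _ fun q : B × Fin 6 → Option Color =>
          ∀ b, Above passBasis fun e => q (b, e) := IsBlackStrategy.pi fun _ => pass_strategy
      obtain ⟨b₀, e⟩ := x
      -- White moves in one of the two fresh units; stated for an ordered pair, so that it serves
      -- for either of them.
      have attacked : ∀ b b', b ≠ b' → (grp b = κ ∧ Above freshBasis fun e => q (b, e)) →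
          (grp b' = κ ∧ Above freshBasis fun e => q (b', e)) → b₀ = b →
          Linked grp κ (Function.update q (b₀, e) (some Color.white)) ∨
          ∃ y, y ≠ (b₀, e) ∧ q y = none ∧ Linked grp κ (Function.update
            (Function.update q (b₀, e) (some Color.white)) y (some Color.black)) := by
        rintro _ b' hbb' ⟨h1, h2⟩ ⟨h3, h4⟩ rfl
        rcases fresh_answer h2 hx with h5 | ⟨e', he', hq', h5⟩
        · have h6 : ∀ b, Above passBasis fun e' =>
              Function.update q (b₀, e) (some Color.white) (b, e') := by
            intro b
            rw [update_fiber]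
            split_ifs
            · exact h5
            · exact h b
          -- The attacked unit passes without an answer, so Black's move is free for hooking `b'`.
          rcases hook_of_fresh h4 with h7 | ⟨y, hy, h7⟩
          · refine Or.inl (Or.inl ⟨b', h3, .of_pass h6 ?_⟩)
            rwa [update_fiber, if_neg hbb'.symm]
          · refine Or.inr ⟨(b', y), by simp [hbb'.symm], hy, Or.inl ⟨b', h3, .of_pass ?_ ?_⟩⟩
            · exact fun b => above_update_black (h6 b) _
            · rwa [update_fiber, if_pos rfl, update_fiber, if_neg hbb'.symm]
        · refine Or.inr ⟨(b₀, e'), by simp [he'], hq', Or.inr ⟨fun b => ?_, b₀, b', hbb',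
            ⟨h1, ?_⟩, ⟨h3, ?_⟩⟩⟩
          · rw [update_fiber]
            split_ifs with hb
            · rw [update_fiber, if_pos rfl]; exact pass_of_fresh h5
            · rw [update_fiber, if_neg hb]; exact h b
          · rwa [update_fiber, if_pos rfl, update_fiber, if_pos rfl]
          · rwa [update_fiber, if_neg hbb'.symm, update_fiber, if_neg hbb'.symm]
      by_cases hb : b₀ = b
      · exact attacked b b' hbb' h1 h2 hb
      by_cases hb' : b₀ = b'
      · exact attacked b' b hbb'.symm h2 h1 hb'
      have keep : ∀ {b}, b₀ ≠ b → Above freshBasis (fun e => q (b, e)) →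
          Above freshBasis fun e' => Function.update q (b₀, e) (some Color.white) (b, e') := by
        intro b hb h
        rwa [update_fiber, if_neg (Ne.symm hb)]
      -- White moved outside both fresh units, where only passing has to be preserved.
      rcases pass.answer q _ hx h with h' | ⟨y, hyx, hy, h'⟩
      · exact Or.inl (Or.inr ⟨h', b, b', hbb', ⟨h1.1, keep hb h1.2⟩, ⟨h2.1, keep hb' h2.2⟩⟩)
      · exact Or.inr ⟨y, hyx, hy, Or.inr ⟨h', b, b', hbb',
          ⟨h1.1, above_update_black (keep hb h1.2) y⟩,
          ⟨h2.1, above_update_black (keep hb' h2.2) y⟩⟩⟩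
  final := by
    intro q hq h
    have h' : ∃ b, grp b = κ ∧ Hooked b q := by
      rcases h with h | ⟨h, b, -, -, ⟨h1, h2⟩, -⟩
      · exact h
      · rcases hook_of_fresh h2 with h3 | ⟨y, hy, -⟩
        · exact ⟨b, h1, .of_pass h h3⟩
        · exact absurd hy (hq _)
    obtain ⟨b, hb, h'⟩ := h'
    have := (hooked_strategy b).final q hq h'
    exact ⟨b, hb, (this b).1 rfl, fun b' => (this b').2⟩

-- Reserves of fresh units

variable [Fintype B] [DecidableEq K]

/-- The number of fresh units in the group `κ`. -/
def freshCount (grp : B → K) (κ : K) (q : B × Fin 6 → Option Color) : ℕ :=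
  (Finset.univ.filter fun b => grp b = κ ∧ Above freshBasis fun e => q (b, e)).card

theorem freshCount_le {grp : B → K} {κ : K} {q q' : B × Fin 6 → Option Color}
    (h : ∀ b, Above freshBasis (fun e => q (b, e)) → Above freshBasis fun e => q' (b, e)) :
    freshCount grp κ q ≤ freshCount grp κ q' :=
  Finset.card_le_card fun b => by
    simp only [Finset.mem_filter, Finset.mem_univ, true_and]
    exact fun hb => ⟨hb.1, h b hb.2⟩

theorem freshCount_le_succ {grp : B → K} {κ : K} {q q' : B × Fin 6 → Option Color} (b₀ : B)
    (h : ∀ b ≠ b₀, Above freshBasis (fun e => q (b, e)) → Above freshBasis fun e => q' (b, e)) :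
    freshCount grp κ q ≤ freshCount grp κ q' + 1 := by
  refine (Finset.card_le_card fun b => ?_).trans (Finset.card_insert_le b₀ _)
  simp only [Finset.mem_filter, Finset.mem_univ, true_and, Finset.mem_insert]
  intro hb
  by_cases h0 : b = b₀
  · exact Or.inl h0
  · exact Or.inr ⟨hb.1, h b h0 hb.2⟩

/-- Positions of a chain in which Black, moving second, may ignore `n` moves of White and still
achieves `ChainGoal grp κ` for an arbitrary group `κ`. -/
def Reserve (grp : B → K) (n : ℕ) (q : B × Fin 6 → Option Color) : Prop :=
  (∀ b, Above passBasis fun e => q (b, e)) ∧ ∀ κ, n + 2 ≤ freshCount grp κ q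

/-- The two units in excess of `n` are the pair required by `Linked`, whatever group is chosen. -/
theorem Reserve.linked {grp : B → K} {q : B × Fin 6 → Option Color} {n : ℕ}
    (h : Reserve grp n q) (κ : K) : Linked grp κ q := by
  refine Or.inr ⟨h.1, ?_⟩
  have h1 := h.2 κ
  obtain ⟨b, hb, b', hb', hne⟩ := Finset.one_lt_card.1
    (show 1 < (Finset.univ.filter fun b => grp b = κ ∧ Above freshBasis fun e => q (b, e)).card by
      unfold freshCount at h1; omega)
  simp only [Finset.mem_filter, Finset.mem_univ, true_and] at hb hb'
  exact ⟨b, b', hne, hb, hb'⟩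

theorem Reserve.anti {grp : B → K} {q : B × Fin 6 → Option Color} {n : ℕ}
    (h : Reserve grp (n + 1) q) : Reserve grp n q :=
  ⟨h.1, fun κ => by have := h.2 κ; omega⟩

theorem Reserve.update_black {grp : B → K} {q : B × Fin 6 → Option Color} {n : ℕ}
    (h : Reserve grp n q) (x : B × Fin 6) :
    Reserve grp n (Function.update q x (some Color.black)) :=
  ⟨fun b => above_update_black (h.1 b) x,
    fun κ => (h.2 κ).trans (freshCount_le fun _ hb => above_update_black hb x)⟩

/-- A White stone affects a single unit, so ignoring it costs at most one fresh unit in every group.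
If the unit is fresh, use `fresh_answer`; otherwise no freshness is at stake and the pass strategy
replies. -/
theorem Reserve.answer {grp : B → K} {q : B × Fin 6 → Option Color} {n : ℕ}
    (h : Reserve grp (n + 1) q) {x : B × Fin 6} (hx : q x = none) :
    Reserve grp n (Function.update q x (some Color.white)) ∨ ∃ y, y ≠ x ∧ q y = none ∧
      Reserve grp (n + 1)
        (Function.update (Function.update q x (some Color.white)) y (some Color.black)) := by
  obtain ⟨b₀, e⟩ := x
  have keep : ∀ b ≠ b₀, Above freshBasis (fun e => q (b, e)) →
      Above freshBasis fun e' => Function.update q (b₀, e) (some Color.white) (b, e') := by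
    intro b hb h
    rwa [update_fiber, if_neg hb]
  have ignore : (∀ b, Above passBasis fun e' =>
      Function.update q (b₀, e) (some Color.white) (b, e')) →
      Reserve grp n (Function.update q (b₀, e) (some Color.white)) := fun h' =>
    ⟨h', fun κ => by have := freshCount_le_succ (grp := grp) (κ := κ) b₀ keep; have := h.2 κ; omega⟩
  by_cases hf : Above freshBasis fun e => q (b₀, e)
  · rcases fresh_answer hf hx with h' | ⟨e', he', hq', h'⟩
    · refine Or.inl (ignore fun b => ?_)
      rw [update_fiber]
      split_ifs
      · exact h'
      · exact h.1 b
    · refine Or.inr ⟨(b₀, e'), by simp [he'], hq', fun b => ?_, fun κ => ?_⟩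
      · rw [update_fiber]
        split_ifs with hb
        · rw [update_fiber, if_pos rfl]; exact pass_of_fresh h'
        · rw [update_fiber, if_neg hb]; exact h.1 b
      · refine (h.2 κ).trans (freshCount_le fun b hb => ?_)
        rw [update_fiber]
        split_ifs with hb'
        · rwa [update_fiber, if_pos rfl]
        · rwa [update_fiber, if_neg hb']
  · have pass : IsBlackStrategy _ fun q : B × Fin 6 → Option Color =>
        ∀ b, Above passBasis fun e => q (b, e) := IsBlackStrategy.pi fun _ => pass_strategy
    rcases pass.answer q _ hx h.1 with h' | ⟨y, hyx, hy, h'⟩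
    · exact Or.inl (ignore h')
    · refine Or.inr ⟨y, hyx, hy, h', fun κ => (h.2 κ).trans (freshCount_le fun b hb => ?_)⟩
      exact above_update_black (keep b (fun h => hf (h ▸ hb)) hb) y

variable {S Y T : Type} [DecidableEq S] [Finite Y] [DecidableEq Y]

/-- The play on `Y` decides in which group of each of several chains Black has to link a unit to
its rail. -/
theorem IsBlackStrategy.postpone_chains {Goal : (Y → Color) → Prop}
    {I : (Y → Option Color) → Prop} (hI : IsBlackStrategy Goal I) (grp : B → K) (sel : T → S → K)
    {R : (Y → Color) → T → Prop} (hR : ∀ f, Goal f → ∃ t, R f t) :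
    ∃ I' : ((S × (B × Fin 6)) ⊕ Y → Option Color) → Prop,
      IsBlackStrategy (fun f => ∃ t, R (f ∘ Sum.inr) t ∧
        ∀ s, ChainGoal grp (sel t s) fun z => f (Sum.inl (s, z))) I' ∧
      ∀ p, I (p ∘ Sum.inr) → (∀ s, Reserve grp (emptyCount (p ∘ Sum.inr)) fun z =>
        p (Sum.inl (s, z))) → I' p := by
  have h := hI.postpone (Z := S × (B × Fin 6))
    (GoalZ := fun t f => ∀ s, ChainGoal grp (sel t s) fun z => f (s, z))
    (J := fun t q => ∀ s, Linked grp (sel t s) fun z => q (s, z))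
    (fun t => .pi fun s => linked_strategy grp (sel t s)) hR
    (P := fun n q => ∀ s, Reserve grp n fun z => q (s, z))
    (fun q t h s => (h s).linked _) (fun n q h s => (h s).anti) ?_ ?_
  · exact ⟨_, h, fun p h1 h2 => Or.inl ⟨h1, h2⟩⟩
  · rintro n q ⟨s₀, z⟩ - h s
    rw [update_fiber]
    split_ifs
    · exact (h s₀).update_black z
    · exact h s
  · rintro n q ⟨s₀, z⟩ hz h
    rcases (h s₀).answer hz with h' | ⟨w, hwz, hw, h'⟩
    · refine Or.inl fun s => ?_
      rw [update_fiber]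
      split_ifs
      · exact h'
      · exact (h s).anti
    · refine Or.inr ⟨(s₀, w), by simp [hwz], hw, fun s => ?_⟩
      rw [update_fiber]
      split_ifs with hs
      · rwa [update_fiber, if_pos rfl]
      · rw [update_fiber, if_neg hs]; exact h s

end Chain

/-! ### Filled boards -/

/-- The column and row of a variable cell of a unit. -/
def unitPos : Bool → Fin 6 → ℕ × ℕ
  | true => ![(3, 2), (5, 2), (2, 3), (3, 3), (4, 3), (4, 4)]
  | false => ![(1, 2), (1, 4), (2, 1), (2, 2), (2, 3), (3, 3)]

theorem unitPos_bounds : ∀ o e, 1 ≤ (unitPos o e).1 ∧ (unitPos o e).1 ≤ 5 ∧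
    1 ≤ (unitPos o e).2 ∧ (unitPos o e).2 ≤ 5 := by
  decide +kernel

theorem unitNode_unitPos : ∀ o e,
    unitNode o (unitPos o e).1 (unitPos o e).2 = some (.cell e) := by
  decide +kernel

theorem eq_unitPos {o : Bool} {c j : ℕ} {e : Fin 6} (hc : c < 7) (hj : j < 7)
    (h : unitNode o c j = some (.cell e)) : (c, j) = unitPos o e := by
  have key : ∀ o : Bool, ∀ c j : Fin 7, ∀ e, unitNode o c j = some (.cell e) →
      (c.val, j.val) = unitPos o e := by
    decide +kernel
  exact key o ⟨c, hc⟩ ⟨j, hj⟩ e h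

theorem gridCell_eq_inr {k i j : ℕ} {e : Fin 6} (hj : j < 7) (h : gridCell k i j = Sum.inr e) :
    i % 6 = (unitPos (decide (i / 6 < 2 * k)) e).1 ∧
      j = (unitPos (decide (i / 6 < 2 * k)) e).2 := by
  unfold gridCell at h
  split_ifs at h
  have h' : unitNode (decide (i < 12 * k)) (i % 6) j = some (.cell e) := by
    rcases hn : unitNode (decide (i < 12 * k)) (i % 6) j with _ | _ | _ | _ | _ | e' <;>
      rw [hn] at h <;> simp_all [UnitNode.content]
  rw [show decide (i / 6 < 2 * k) = decide (i < 12 * k) from decide_eq_decide.2 (by omega)]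
  exact Prod.ext_iff.1 (eq_unitPos (by omega) hj h')

/-- The units, given by the half of the board to which they belong (`true` for the left half) and
the distance from the middle. -/
abbrev UnitCell (k : ℕ) : Type := Bool × (Fin (2 * k) × Fin 6)

/-- The number of a unit. -/
def unitIndex {k : ℕ} (s : Bool) (d : Fin (2 * k)) : ℕ :=
  if s then 2 * k - 1 - d else 2 * k + d

theorem unitIndex_lt {k : ℕ} (s : Bool) (d : Fin (2 * k)) : unitIndex s d < 4 * k := by
  have := d.isLt
  unfold unitIndex
  split_ifs <;> omega

theorem unitIndex_lt_half {k : ℕ} (s : Bool) (d : Fin (2 * k)) :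
    decide (unitIndex s d < 2 * k) = s := by
  have := d.isLt
  unfold unitIndex
  cases s
  · simp
  · simp; omega

theorem unitIndex_injective {k : ℕ} {s s' : Bool} {d d' : Fin (2 * k)}
    (h : unitIndex s d = unitIndex s' d') : s = s' ∧ d = d' := by
  have hs : s = s' := by rw [← unitIndex_lt_half s d, h, unitIndex_lt_half]
  subst hs
  refine ⟨rfl, Fin.ext ?_⟩
  have := d.isLt
  have := d'.isLt
  unfold unitIndex at h
  split_ifs at h <;> omega

theorem exists_unitIndex {k b : ℕ} (hb : b < 4 * k) :
    ∃ (s : Bool) (d : Fin (2 * k)), unitIndex s d = b := by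
  by_cases h : b < 2 * k
  · refine ⟨true, ⟨2 * k - 1 - b, by omega⟩, ?_⟩
    simp only [unitIndex, if_true]
    omega
  · refine ⟨false, ⟨b - 2 * k, by omega⟩, ?_⟩
    simp only [unitIndex, Bool.false_eq_true, if_false]
    omega

/-- The cell of the board that corresponds to a variable cell. -/
def varCell {k : ℕ} {hk : 0 < k} {s : UnitState} (z : UnitCell k) :
    ThreeTerminalPosition.Cells (unitBoard k hk s) :=
  ⟨(⟨6 * unitIndex z.1 z.2.1 + (unitPos z.1 z.2.2).1, by
      have := unitIndex_lt z.1 z.2.1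
      have := (unitPos_bounds z.1 z.2.2).2.1
      change _ < 24 * k + 1
      omega⟩,
    ⟨(unitPos z.1 z.2.2).2, (unitPos_bounds z.1 z.2.2).2.2.2.trans_lt (by decide : 5 < 7)⟩),
    (unitPos_bounds z.1 z.2.2).2.2.1,
    (unitPos_bounds z.1 z.2.2).2.2.2.trans_lt (by decide : 5 < 6)⟩

section FilledBoard

variable {k : ℕ} {hk : 0 < k} {s : UnitState}

theorem gridCell_varCell (z : UnitCell k) :
    gridCell k (varCell (hk := hk) (s := s) z).1.1 (varCell (hk := hk) (s := s) z).1.2 =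
      Sum.inr z.2.2 := by
  obtain ⟨h1, h2, h3, h4⟩ := unitPos_bounds z.1 z.2.2
  have h5 := unitIndex_lt_half z.1 z.2.1
  change gridCell k (6 * unitIndex z.1 z.2.1 + (unitPos z.1 z.2.2).1) (unitPos z.1 z.2.2).2 = _
  unfold gridCell
  rw [if_neg (by omega), show decide (6 * unitIndex z.1 z.2.1 + (unitPos z.1 z.2.2).1 < 12 * k) =
    decide (unitIndex z.1 z.2.1 < 2 * k) from decide_eq_decide.2 (by omega), h5,
    show (6 * unitIndex z.1 z.2.1 + (unitPos z.1 z.2.2).1) % 6 = (unitPos z.1 z.2.2).1 by omega,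
    unitNode_unitPos]
  rfl

theorem varCell_div (z : UnitCell k) :
    (varCell (hk := hk) (s := s) z).1.1.val / 6 = unitIndex z.1 z.2.1 := by
  obtain ⟨h1, h2, h3, h4⟩ := unitPos_bounds z.1 z.2.2
  simp only [varCell]
  omega

theorem varCell_injective : Function.Injective (varCell (k := k) (hk := hk) (s := s)) := by
  rintro ⟨o, d, e⟩ ⟨o', d', e'⟩ h
  have h1 := varCell_div (hk := hk) (s := s) (o, d, e)
  have h2 := gridCell_varCell (hk := hk) (s := s) (o, d, e)
  rw [h, varCell_div] at h1
  rw [h, gridCell_varCell] at h2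
  obtain ⟨rfl, rfl⟩ := unitIndex_injective h1
  simpa using h2.symm

theorem exists_varCell {x : ThreeTerminalPosition.Cells (unitBoard k hk s)} {e : Fin 6}
    (h : gridCell k x.1.1 x.1.2 = Sum.inr e) :
    ∃ o d, unitIndex o d = x.1.1.val / 6 ∧ varCell (o, d, e) = x := by
  obtain ⟨⟨i, j⟩, hx⟩ := x
  have hi : i.val < 24 * k + 1 := i.isLt
  have hj : j.val < 7 := j.isLt
  obtain ⟨h1, h2⟩ := gridCell_eq_inr hj h
  obtain ⟨h3, h4, -⟩ := unitPos_bounds (decide (i.val / 6 < 2 * k)) e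
  obtain ⟨o, d, hod⟩ := exists_unitIndex (k := k) (b := i.val / 6) (by simp only at h1; omega)
  have ho := unitIndex_lt_half o d
  rw [hod] at ho
  simp only at h1 h2
  rw [ho] at h1 h2
  refine ⟨o, d, hod, Subtype.ext (Prod.ext (Fin.ext ?_) (Fin.ext h2.symm))⟩
  simp only [varCell, hod]
  omega

/-- The contents of the units of a filled board. -/
noncomputable def unitFill (f : UnitCell k → Color) (b : ℕ) (e : Fin 6) : Color :=
  open Classical in
  if h : ∃ x : Bool × Fin (2 * k), unitIndex x.1 x.2 = b then f (h.choose.1, h.choose.2, e)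
  -- The index `4 * k` does occur, through the last column, but that column has no variable cell, so
  -- the default is irrelevant.
  else Color.white

theorem unitFill_unitIndex (f : UnitCell k → Color) (o : Bool) (d : Fin (2 * k)) :
    unitFill f (unitIndex o d) = fun e => f (o, d, e) := by
  have h : ∃ x : Bool × Fin (2 * k), unitIndex x.1 x.2 = unitIndex o d := ⟨(o, d), rfl⟩
  obtain ⟨h1, h2⟩ := unitIndex_injective h.choose_spec
  funext e
  rw [unitFill, dif_pos h, h1, h2]

/-- The filled region contains the fixed stones of the units. -/
def RespectsGrid (f : ThreeTerminalPosition.Cells (unitBoard k hk s) → Color) : Prop :=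
  ∀ x c, gridCell k x.1.1 x.1.2 = Sum.inl c → f x = c

theorem colorAt_unitFill {f : ThreeTerminalPosition.Cells (unitBoard k hk s) → Color}
    (hf : RespectsGrid f) (x : ThreeTerminalPosition.Cells (unitBoard k hk s)) :
    colorAt k (unitFill (f ∘ varCell)) x.1.1 x.1.2 = f x := by
  unfold colorAt
  rcases h : gridCell k x.1.1 x.1.2 with c | e
  · exact (hf x c h).symm
  · obtain ⟨o, d, h1, h2⟩ := exists_varCell h
    rw [← h1, unitFill_unitIndex, Sum.elim_inr, Function.comp_apply, h2]

theorem mem_blackSet_iff {f : ThreeTerminalPosition.Cells (unitBoard k hk s) → Color}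
    (hf : RespectsGrid f) (x : HexCell (24 * k + 1) 7) :
    Sum.inl x ∈ ThreeTerminalPosition.blackSet (unitBoard k hk s) f ↔
      colorAt k (unitFill (f ∘ varCell)) x.1 x.2 = Color.black := by
  have hx7 : x.2.val < 7 := x.2.isLt
  have hrail : (Sum.inl x : HexVertex (24 * k + 1) 7) ∈ ⋃ i, railTerminal k i ↔
      x.2.val = 0 ∧ x.1.val ≠ 6 * k ∧ x.1.val ≠ 18 * k := by
    simp only [Set.mem_iUnion, railTerminal, Set.mem_ofPred_eq]
    constructor
    · rintro ⟨i, y, h, h1, h2, h3, -⟩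
      obtain rfl := Sum.inl_injective h
      exact ⟨h1, h2, h3⟩
    · rintro ⟨h1, h2, h3⟩
      exact ⟨_, x, rfl, h1, h2, h3, rfl⟩
  by_cases hx : x ∈ innerRegion k
  · have h := colorAt_unitFill hf ⟨x, hx⟩
    simp only at h
    rw [h]
    constructor
    · rintro (⟨y, hy, hy'⟩ | h')
      · obtain rfl := Sum.inl_injective hy
        exact hy'
      · have := hrail.1 h'
        have := hx.1
        omega
    · exact fun h' => Or.inl ⟨⟨x, hx⟩, rfl, h'⟩
  · have hx' : ¬ (0 < x.2.val ∧ x.2.val < 6) := hx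
    have h1 : (Sum.inl x : HexVertex (24 * k + 1) 7) ∈
        ThreeTerminalPosition.blackSet (unitBoard k hk s) f ↔
        (Sum.inl x : HexVertex (24 * k + 1) 7) ∈ ⋃ i, railTerminal k i := by
      constructor
      · rintro (⟨y, hy, -⟩ | h')
        · obtain rfl := Sum.inl_injective hy
          exact absurd y.2 hx
        · exact h'
      · exact Or.inr
    refine h1.trans (hrail.trans ?_)
    rcases Nat.eq_zero_or_pos x.2.val with h0 | h0
    · rw [h0, colorAt_top]
      tauto
    · have h6 : x.2.val = 6 := by omega
      simp [colorAt, gridCell, h6, unitNode_six, UnitNode.content]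

theorem edge_notMem_blackSet {f : ThreeTerminalPosition.Cells (unitBoard k hk s) → Color}
    (e : HexEdge) : Sum.inr e ∉ ThreeTerminalPosition.blackSet (unitBoard k hk s) f := by
  rintro (⟨x, h, -⟩ | h)
  · exact Sum.inr_ne_inl h
  · obtain ⟨i, x, h, -⟩ := Set.mem_iUnion.1 h
    exact Sum.inr_ne_inl h

theorem blackStep_iff {f : ThreeTerminalPosition.Cells (unitBoard k hk s) → Color}
    (hf : RespectsGrid f) (x y : HexCell (24 * k + 1) 7) :
    ThreeTerminalPosition.BlackStep (unitBoard k hk s) f (Sum.inl x) (Sum.inl y) ↔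
      CoordStep k (unitFill (f ∘ varCell)) (x.1, x.2) (y.1, y.2) := by
  have h1 : x.1.val ≤ 24 * k := Nat.le_of_lt_succ x.1.isLt
  have h2 : y.1.val ≤ 24 * k := Nat.le_of_lt_succ y.1.isLt
  unfold ThreeTerminalPosition.BlackStep CoordStep
  refine and_congr hexGraph_adj_cell (and_congr ?_ ?_)
  · exact (mem_blackSet_iff hf x).trans ⟨fun h => ⟨h1, x.2.isLt, h⟩, fun h => h.2.2⟩
  · exact (mem_blackSet_iff hf y).trans ⟨fun h => ⟨h2, y.2.isLt, h⟩, fun h => h.2.2⟩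

theorem conn_of_reach {f : ThreeTerminalPosition.Cells (unitBoard k hk s) → Color}
    (hf : RespectsGrid f) {i i' : ℕ} (hi : i ≤ 24 * k ∧ i ≠ 6 * k ∧ i ≠ 18 * k)
    (hi' : i' ≤ 24 * k ∧ i' ≠ 6 * k ∧ i' ≠ 18 * k)
    (h : Relation.ReflTransGen (CoordStep k (unitFill (f ∘ varCell))) (i, 0) (i', 0)) :
    ThreeTerminalPosition.Conn (unitBoard k hk s) f (railOf k i) (railOf k i') := by
  have key : ∀ a, Relation.ReflTransGen (CoordStep k (unitFill (f ∘ varCell))) (i, 0) a →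
      ∃ x : HexCell (24 * k + 1) 7, (x.1.val, x.2.val) = a ∧ Relation.ReflTransGen
        (ThreeTerminalPosition.BlackStep (unitBoard k hk s) f)
        (Sum.inl (⟨i, Nat.lt_succ_of_le hi.1⟩, (0 : Fin 7))) (Sum.inl x) := by
    intro a ha
    induction ha with
    | refl => exact ⟨_, rfl, .refl⟩
    | @tail a b _ hab ih =>
      obtain ⟨x, rfl, hx⟩ := ih
      have hb := hab.2.2
      refine ⟨(⟨b.1, Nat.lt_succ_of_le hb.1⟩, ⟨b.2, hb.2.1⟩), rfl, hx.tail ?_⟩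
      exact (blackStep_iff hf _ _).2 hab
  obtain ⟨x, hx, hreach⟩ := key _ h
  simp only [Prod.mk.injEq] at hx
  refine ⟨_, ⟨_, rfl, rfl, hi.2.1, hi.2.2, rfl⟩, _, ⟨x, rfl, hx.2, ?_, ?_, ?_⟩, hreach⟩
  · rw [hx.1]; exact hi'.2.1
  · rw [hx.1]; exact hi'.2.2
  · rw [hx.1]

theorem reach_of_conn {f : ThreeTerminalPosition.Cells (unitBoard k hk s) → Color}
    (hf : RespectsGrid f) {t t' : Fin 3}
    (h : ThreeTerminalPosition.Conn (unitBoard k hk s) f t t') :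
    ∃ i i', railOf k i = t ∧ railOf k i' = t' ∧
      Relation.ReflTransGen (CoordStep k (unitFill (f ∘ varCell))) (i, 0) (i', 0) := by
  obtain ⟨u, ⟨x, rfl, hx, -, -, hxt⟩, v, ⟨y, rfl, hy, -, -, hyt⟩, h⟩ := h
  have key : ∀ v, Relation.ReflTransGen
      (ThreeTerminalPosition.BlackStep (unitBoard k hk s) f) (Sum.inl x) v →
      ∃ y : HexCell (24 * k + 1) 7, v = Sum.inl y ∧ Relation.ReflTransGen
        (CoordStep k (unitFill (f ∘ varCell))) (x.1.val, x.2.val) (y.1.val, y.2.val) := by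
    intro v hv
    induction hv with
    | refl => exact ⟨x, rfl, .refl⟩
    | @tail u v _ huv ih =>
      obtain ⟨y, rfl, hy⟩ := ih
      rcases v with z | e
      · exact ⟨z, rfl, hy.tail ((blackStep_iff hf _ _).1 huv)⟩
      · exact absurd huv.2.2 (edge_notMem_blackSet e)
  obtain ⟨z, hz, hreach⟩ := key _ h
  obtain rfl := Sum.inl_injective hz
  rw [hx, hy] at hreach
  exact ⟨_, _, hxt, hyt, hreach⟩

/-- The group of a unit: `true` if it belongs to the half of the units nearer to the middle. -/
def nearMiddle (d : Fin (2 * k)) : Bool := decide (d.val < k)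

/-- The rail of a group of units. -/
def groupRail : Bool → Bool → Fin 3
  | _, true => 1
  | true, false => 0
  | false, false => 2

theorem unitRail_unitIndex (o : Bool) (d : Fin (2 * k)) :
    unitRail k (unitIndex o d) = groupRail o (nearMiddle d) := by
  have := d.isLt
  unfold unitRail unitIndex nearMiddle
  cases o <;> by_cases h : d.val < k <;> simp only [h, decide_true, decide_false, groupRail] <;>
    split_ifs <;> first | rfl | omega | simp_all

/-- Walk outward from the middle port through the passing units to the first port of the hooked
unit, and from there to its rail. -/
theorem reach_of_chainGoal {f : UnitCell k → Color} {o κ : Bool}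
    (h : ChainGoal nearMiddle κ fun z => f (o, z)) :
    ∃ i, (i ≤ 24 * k ∧ i ≠ 6 * k ∧ i ≠ 18 * k) ∧ railOf k i = groupRail o κ ∧
      Relation.ReflTransGen (CoordStep k (unitFill f)) (12 * k, 5) (i, 0) := by
  obtain ⟨d, rfl, hhook, hpass⟩ := h
  have hlt := unitIndex_lt o d
  have hd := d.isLt
  obtain ⟨c, hc, hc', hreach⟩ := reach_of_hookGoal (g := unitFill f) hlt
    (by rw [unitFill_unitIndex]; exact hhook)
  refine ⟨6 * unitIndex o d + c, by omega, ?_, .trans ?_ hreach⟩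
  · rw [railOf_unit hc hc', unitRail_unitIndex]
  have hpass' : ∀ (d' : ℕ) (h : d' < 2 * k), d' < d.val →
      PassGoal (unitFill f (unitIndex o ⟨d', h⟩)) := by
    intro d' h h'
    rw [unitFill_unitIndex]
    exact hpass ⟨d', h⟩ h'
  have hsymm : ∀ {a b}, Relation.ReflTransGen (CoordStep k (unitFill f)) a b →
      Relation.ReflTransGen (CoordStep k (unitFill f)) b a :=
    reflTransGen_symm fun _ _ => CoordStep.symm
  cases o with
  | true =>
    have key : ∀ n ≤ d.val, Relation.ReflTransGen (CoordStep k (unitFill f)) (12 * k, 5)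
        (6 * (2 * k - n), 5) := by
      intro n
      induction n with
      | zero =>
        intro _
        rw [show 6 * (2 * k - 0) = 12 * k by omega]
      | succ n ih =>
        intro hn
        -- In the left half the walk runs against the numbering of the units, hence the reversed
        -- path.
        refine (ih (by omega)).trans (hsymm ?_)
        have := reach_of_passGoal (unitIndex_lt _ _) (hpass' n (by omega) (by omega))
        simp only [unitIndex, if_true] at this
        rwa [show 2 * k - 1 - n + 1 = 2 * k - n by omega,
          show 2 * k - 1 - n = 2 * k - (n + 1) by omega] at this
    have := key d le_rfl
    simp only [firstPort, unitIndex, if_true]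
    rw [if_pos (by omega)]
    rwa [show 2 * k - 1 - d.val + 1 = 2 * k - d by omega]
  | false =>
    have key : ∀ n ≤ d.val, Relation.ReflTransGen (CoordStep k (unitFill f)) (12 * k, 5)
        (6 * (2 * k + n), 5) := by
      intro n
      induction n with
      | zero =>
        intro _
        rw [show 6 * (2 * k + 0) = 12 * k by omega]
      | succ n ih =>
        intro hn
        refine (ih (by omega)).trans ?_
        exact reach_of_passGoal (unitIndex_lt _ _) (hpass' n (by omega) (by omega))
    have := key d le_rfl
    simp only [firstPort, unitIndex, Bool.false_eq_true, if_false]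
    rwa [if_neg (by omega)]

/-- The groups of units that have to be linked to their rails in order to obtain the outcome `x`
or a better one: the first argument is the outcome, the second one is the half of the board. -/
def groupFor : Outcome3 → Bool → Bool
  | .a, o => o
  | .c, o => !o
  | _, _ => false

/-- Both halves start at the same middle port, so the rails reached on the two sides are linked;
`groupFor` selects the right pair of rails for `x`. -/
theorem le_outcome_of_chainGoal {f : ThreeTerminalPosition.Cells (unitBoard k hk s) → Color}
    (hf : RespectsGrid f) {x : Outcome3} (hx : x = .a ∨ x = .b ∨ x = .c)
    (h : ∀ o, ChainGoal nearMiddle (groupFor x o) fun z => f (varCell (o, z))) :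
    x ≤ ThreeTerminalPosition.outcome (unitBoard k hk s) f := by
  obtain ⟨i, hi, hri, h1⟩ := reach_of_chainGoal (f := f ∘ varCell) (h true)
  obtain ⟨i', hi', hri', h2⟩ := reach_of_chainGoal (f := f ∘ varCell) (h false)
  have h3 := conn_of_reach hf hi hi' ((reflTransGen_symm (fun _ _ => CoordStep.symm) h1).trans h2)
  rw [hri, hri'] at h3
  rcases hx with rfl | rfl | rfl
  · exact ThreeTerminalPosition.a_le_outcome_iff.2 h3
  · exact ThreeTerminalPosition.b_le_outcome_iff.2 h3
  · exact ThreeTerminalPosition.c_le_outcome_iff.2 h3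

/-- This turns the global outcome `top` into a local event, which White can prevent unit by unit. -/
theorem exists_leak_of_outcome {f : ThreeTerminalPosition.Cells (unitBoard k hk s) → Color}
    (hf : RespectsGrid f)
    (h : Outcome3.top ≤ ThreeTerminalPosition.outcome (unitBoard k hk s) f) :
    ∃ o d, LeakGoal fun e => f (varCell (o, d, e)) := by
  by_contra! hleak
  have hleak' : ∀ b < 4 * k, ¬ LeakGoal (unitFill (f ∘ varCell) b) := by
    intro b hb
    obtain ⟨o, d, rfl⟩ := exists_unitIndex hb
    rw [unitFill_unitIndex]
    exact hleak o d
  obtain ⟨-, h02, h01⟩ := ThreeTerminalPosition.outcome_eq_top_iff.1 (top_le_iff.1 h)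
  obtain ⟨i, i', h1, h2, h3⟩ := reach_of_conn hf h01
  obtain ⟨j, j', h4, h5, h6⟩ := reach_of_conn hf h02
  exact not_all_linked hk hleak' h1 h2 h4 h5 h3 h6

theorem chainGoal_of_black (hk : 0 < k) {f : Fin (2 * k) × Fin 6 → Color}
    (hf : ∀ z, f z = Color.black) (κ : Bool) : ChainGoal nearMiddle κ f := by
  have h : ∃ d : Fin (2 * k), nearMiddle d = κ := by
    cases κ
    · exact ⟨⟨k, by omega⟩, by simp [nearMiddle]⟩
    · exact ⟨⟨0, by omega⟩, by simp [nearMiddle, hk]⟩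
  obtain ⟨d, hd⟩ := h
  exact ⟨d, hd, by simp [HookGoal, hf], fun _ _ => by simp [PassGoal, hf]⟩

end FilledBoard

/-! ### The game on the family of boards -/

/-- The board all of whose variable cells are empty. -/
abbrev openBoard (k : ℕ) (hk : 0 < k) : ThreeTerminalPosition := unitBoard k hk fun _ => none

/-- The board all of whose variable cells are black. -/
abbrev blackBoard : ThreeTerminalPosition := unitBoard 1 one_pos fun _ => some Color.black

theorem GameForm.equiv_atom_of_le {A : Type} [PartialOrder A] [OrderTop A] {G : GameForm A}
    (h : Le (atom ⊤) G) : Equiv G (atom ⊤) := ⟨(le_atom_top G).1, h⟩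

theorem blackBoard_state_ne_none (x) : blackBoard.state x ≠ none := by
  change gridStones 1 (fun _ => some Color.black) x.1 ≠ none
  unfold gridStones
  cases gridCell 1 x.1.1 x.1.2 <;> simp

theorem blackBoard_form : GameForm.Equiv blackBoard.form (GameForm.atom Outcome3.top) := by
  refine GameForm.equiv_atom_of_le ?_
  unfold ThreeTerminalPosition.form
  rw [positionForm_of_full _ blackBoard_state_ne_none]
  have hf : RespectsGrid (k := 1) (hk := one_pos) (s := fun _ => some Color.black)
      fun x => (blackBoard.state x).getD Color.white := by
    intro x c h
    change (gridStones 1 (fun _ => some Color.black) x.1).getD Color.white = c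
    simp [gridStones, h]
  have hv : ∀ z : UnitCell 1, (blackBoard.state (varCell z)).getD Color.white = Color.black := by
    intro z
    change (gridStones 1 (fun _ => some Color.black) (varCell z).1).getD Color.white = Color.black
    unfold gridStones
    rw [gridCell_varCell]
    rfl
  have hle : ∀ x : Outcome3, x = .a ∨ x = .b ∨ x = .c → x ≤ _ := fun x hx =>
    le_outcome_of_chainGoal hf hx fun o => chainGoal_of_black one_pos (fun z => hv (o, z)) _
  have htop : blackBoard.outcome (fun x => (blackBoard.state x).getD Color.white) = Outcome3.top :=
    ThreeTerminalPosition.outcome_eq_top_iff.2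
      ⟨ThreeTerminalPosition.a_le_outcome_iff.1 (hle _ (by simp)),
        ThreeTerminalPosition.b_le_outcome_iff.1 (hle _ (by simp)),
        ThreeTerminalPosition.c_le_outcome_iff.1 (hle _ (by simp))⟩
  rw [htop]
  exact (GameForm.le_atom_top _).1

section OpenBoard

variable {k : ℕ} {hk : 0 < k}

theorem openBoard_state_varCell (z : UnitCell k) : (openBoard k hk).state (varCell z) = none := by
  change gridStones k (fun _ => none) (varCell z).1 = none
  unfold gridStones
  rw [gridCell_varCell]
  rfl

theorem openBoard_state_ne_none (x : (openBoard k hk).Cells) (hx : x ∉ Set.range varCell) :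
    (openBoard k hk).state x ≠ none := by
  change gridStones k (fun _ => none) x.1 ≠ none
  unfold gridStones
  rcases h : gridCell k x.1.1 x.1.2 with c | e
  · simp
  · obtain ⟨o, d, -, h⟩ := exists_varCell h
    exact absurd ⟨_, h⟩ hx

theorem respectsGrid_of_state {f : (openBoard k hk).Cells → Color}
    (hf : ∀ x, x ∉ Set.range varCell → (openBoard k hk).state x = some (f x)) :
    RespectsGrid f := by
  intro x c hx
  have hr : x ∉ Set.range varCell := by
    rintro ⟨z, rfl⟩
    rw [gridCell_varCell] at hx
    exact Sum.inr_ne_inl hx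
  have h : gridStones k (fun _ => none) x.1 = some (f x) := hf x hr
  unfold gridStones at h
  rw [hx] at h
  exact (Option.some_injective _ h).symm

/-- White, moving second, prevents the three terminals from being linked. -/
theorem not_equiv_openBoard_form :
    ¬ GameForm.Equiv (openBoard k hk).form (GameForm.atom Outcome3.top) := by
  rintro ⟨-, h⟩
  have hB := isBlackStrategy_le (openBoard k hk).outcome Outcome3.top
    fun f g hfg hf => hf.trans (ThreeTerminalPosition.outcome_mono hfg)
  have hW := IsWhiteStrategy.extend (varCell_injective (hk := hk) (s := fun _ => none))
    openBoard_state_ne_none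
    (.pi fun _ : Bool => .pi fun _ : Fin (2 * k) => safe_strategy)
    (Goal := fun f => Outcome3.top ≤ (openBoard k hk).outcome f)
    fun f hf hgoal => exists_leak_of_outcome (respectsGrid_of_state hf) hgoal
  refine hB.false_of_isWhiteStrategy hW (p := (openBoard k hk).state)
    ⟨_, Dominates.refl _, h⟩ ⟨fun _ _ => rfl, fun o d => ?_⟩
  have : (fun e => ((openBoard k hk).state ∘ varCell) (o, d, e)) = fun _ => none :=
    funext fun e => openBoard_state_varCell _
  rw [this]
  -- The empty unit is itself an entry of `safeBasis`.
  decide +kernel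

theorem reserve_of_empty {n : ℕ} (hn : n + 2 ≤ k) {q : Fin (2 * k) × Fin 6 → Option Color}
    (hq : ∀ z, q z = none) : Reserve nearMiddle n q := by
  have hf : ∀ b, Above freshBasis fun e => q (b, e) := by
    intro b
    simp only [hq]
    decide +kernel
  refine ⟨fun b => pass_of_fresh (hf b), fun κ => hn.trans ?_⟩
  unfold freshCount
  simp only [hf, and_true]
  -- Each half has exactly `k` distances in each group: `i` for the near group and `k + i` for the
  -- far one, with `i < k`.
  refine (Finset.card_range k).ge.trans (Finset.card_le_card_of_injOn
    (fun i => if h : i < k then ⟨if κ then i else k + i, by split_ifs <;> omega⟩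
      else ⟨0, by omega⟩) ?_ ?_)
  · intro i hi
    have hi' : i < k := by simpa using hi
    cases κ <;> simp [hi', nearMiddle]
  · intro i hi j hj h
    have hi' : i < k := by simpa using hi
    have hj' : j < k := by simpa using hj
    cases κ <;> simpa [hi', hj'] using h

/-- If Black, moving second, wins in a context whose hole has all terminals linked, then Black,
moving second, wins after plugging in a sufficiently large board. -/
theorem plug_openBoard {C : HexContext} {I : (C.Cells → Option Color) → Prop}
    (hI : IsBlackStrategy (fun f => C.BlackWins f Outcome3.top) I) (hC : I C.state)
    (hn : emptyCount C.state + 2 ≤ k) :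
    GameForm.Equiv (C.plug (openBoard k hk)) (GameForm.atom ⊤) := by
  refine GameForm.equiv_atom_of_le ?_
  -- The postponed decision is the single link `x` that Black needs; the two chains are the halves
  -- of the board, and `groupFor` tells each of them which rail to reach.
  obtain ⟨I', hI', hstart⟩ := hI.postpone_chains (nearMiddle (k := k)) groupFor
    (R := fun f x => (x = .a ∨ x = .b ∨ x = .c) ∧ C.BlackWins f x) fun f hf => hf.exists_single
  have hinj : Function.Injective (Sum.map (varCell (hk := hk) (s := fun _ => none))
      (id : C.Cells → C.Cells)) := varCell_injective.sumMap Function.injective_id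
  have hB := IsBlackStrategy.extend hinj
    (q := Sum.elim (openBoard k hk).state C.state) ?_ hI'
    (Goal := fun f => ⊤ ≤ C.plugOutcome (openBoard k hk) f) ?_
  · refine hB.le_positionForm ⟨fun _ _ => rfl, hstart _ hC fun o => ?_⟩
    exact reserve_of_empty hn fun z => openBoard_state_varCell _
  · rintro (x | y) hx
    · exact openBoard_state_ne_none x fun ⟨z, hz⟩ => hx ⟨Sum.inl z, congrArg Sum.inl hz⟩
    · exact absurd ⟨Sum.inr y, rfl⟩ hx
  · rintro f hf ⟨x, ⟨hx, hwin⟩, hchain⟩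
    rw [HexContext.top_le_plugOutcome_iff]
    refine hwin.mono (fun _ h => h) (le_outcome_of_chainGoal ?_ hx hchain)
    refine respectsGrid_of_state fun x hx => hf (Sum.inl x) ?_
    rintro ⟨z | y, hz⟩
    · exact hx ⟨z, Sum.inl_injective hz⟩
    · exact Sum.inr_ne_inl hz

end OpenBoard

theorem mainTheorem7 :
    ¬ ∃ C : HexContext, ∀ G : ThreeTerminalPosition,
      GameForm.Equiv (HexContext.plug C G) (GameForm.atom ⊤) ↔
        GameForm.Equiv (ThreeTerminalPosition.form G) (GameForm.atom Outcome3.top) := by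
  rintro ⟨C, hC⟩
  obtain ⟨-, hplug⟩ := (hC blackBoard).2 blackBoard_form
  -- All moves are in the context because `blackBoard` is full, so Black's win becomes a strategy on
  -- the cells of `C` alone.
  have hI := (isBlackStrategy_le (C.plugOutcome blackBoard) ⊤
    fun f g => HexContext.plugOutcome_mono).restrict blackBoard_state_ne_none
  have hI' : IsBlackStrategy (fun f => C.BlackWins f Outcome3.top) _ :=
    ⟨hI.mono, hI.answer, fun p hp h =>
      -- Replacing the outcome of the plugged board by `top` only helps Black.
      (HexContext.top_le_plugOutcome_iff.1 (hI.final p hp h)).mono (fun _ h => h) le_top⟩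
  -- The size allows one ignored move per empty cell of the context and still leaves two fresh units
  -- in each group.
  exact not_equiv_openBoard_form (hk := Nat.succ_pos _)
    ((hC (openBoard (emptyCount C.state + 2) _)).1
      (plug_openBoard hI' ⟨_, Dominates.refl _, hplug⟩ le_rfl))
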